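/- Let $\mathbb F$ be $\mathbb R$ or $\mathbb C$, and let $p \ge 1$ be a computable real number. Then there is a computable operator $F : 2^{\mathbb N} \to \mathbb N^{\mathbb N}$ such that, for every $f \in 2^{\mathbb N}$ and every countable linear order $L$, if $f$ is the diagram of $L$, then there are a $\sigma$-finite measure space $\Omega$ and a presentation $L^p(\Omega)^\#$ of the Banach space $L^p(\Omega)$ over $\mathbb F$ such that 1. $F(f)$ is a name of $L^p(\Omega)^\#$; 2. the number of atoms of $\Omega$ (counted up to null sets) equals the number of adjacencies of $L$; 3. if some interval of $L$ is isomorphic to $\mathbb Q$, then there is a linear isometric embedding of $L^p[0,1]$ into $L^p(\Omega)$. Here $f$ is the diagram of $L$ if the elements of $L$ are identified with distinct natural numbers (for instance, all of $\mathbb N$) so that $f(\langle m,n\rangle)=1$ exactly when $m,n\in L$ and $m\le_L n$. An interval of $L$ is an order-convex subset, and an adjacency of $L$ is a pair $a<b$ in $L$ with no element strictly between. A presentation of a Banach space $\mathcal B$ is a sequence $(v_j)_{j \in \mathbb N}$ of vectors whose linear span is dense in $\mathcal B$. Its rational vectors are the finite sums $\sum_j \alpha_j v_j$ with $\alpha_j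 \in \mathbb F \cap \mathbb Q(i)$. Fix a standard effective coding $m \mapsto R_m$ of the rational vectors and a standard effective enumeration $(I_n)_{n}$ of the bounded open intervals of $\mathbb R$ with rational centre and positive rational radius. The diagram of the presentation is the set of codes $\langle m,n\rangle$ with $\|R_m\| \in I_n$, and a name of the presentation is a function $g \in \mathbb N^{\mathbb N}$ whose range is the diagram. The operator $F$ is computable if a single algorithm computes $F(f)(n)$ from $n$ and finitely many values of $f$. -/

import Mathlib

open MeasureTheory
open scoped ENNReal

/-! ### Computability -/

/-- The rational number `(a - b) / (c + 1)` coded by the triple `(a, b, c)`. -/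
def ratOfCode (q : ℕ × ℕ × ℕ) : ℚ := ((q.1 : ℚ) - q.2.1) / (q.2.2 + 1)

/-- A real `x` is computable if some algorithm computes, from `k`, (a code of) a rational number
at distance less than `2⁻ᵏ` from `x`. -/
def IsComputableReal (x : ℝ) : Prop :=
  ∃ q : ℕ → ℕ × ℕ × ℕ, Computable q ∧ ∀ k, |x - (ratOfCode (q k) : ℝ)| < (1 / 2 : ℝ) ^ k

/-- The finite string `f 0, …, f (k - 1)`. -/
def initialSegment (f : ℕ → Bool) (k : ℕ) : List Bool := (List.range k).map f

/-- A (total) computable operator from Cantor space to Baire space: there is one algorithm `φ`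
which, given a finite initial segment of `f` and an argument `n`, either answers or asks for more
of `f`; all its answers equal `F f n`, and it answers when it has seen enough of `f`. -/
def IsComputableOperator (F : (ℕ → Bool) → (ℕ → ℕ)) : Prop :=
  ∃ φ : List Bool → ℕ → Option ℕ, Computable₂ φ ∧
    ∀ (f : ℕ → Bool) (n : ℕ),
      (∃ k, φ (initialSegment f k) n = some (F f n)) ∧
      ∀ k m, φ (initialSegment f k) n = some m → m = F f n

/-! ### Linear orders -/

/-- `f` is the diagram of (a copy of) `L`: the elements of `L` are represented by distinct natural
numbers, and `f ⟨m, n⟩ = 1` exactly when `m` and `n` represent elements `a ≤ b` of `L`. -/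
def IsDiagramOf (f : ℕ → Bool) (L : Type*) [LinearOrder L] : Prop :=
  ∃ e : L ↪ ℕ, ∀ m n, f (Nat.pair m n) = true ↔ ∃ a b : L, e a = m ∧ e b = n ∧ a ≤ b

/-- The number of adjacencies of `L`, i.e. of pairs `a < b` with nothing strictly in between. -/
noncomputable def numAdjacencies (L : Type*) [LinearOrder L] : ℕ∞ :=
  ENat.card {x : L × L // x.1 ⋖ x.2}

/-- Some interval (order-convex subset) of `L` is isomorphic to `ℚ`. -/
def HasRationalInterval (L : Type*) [LinearOrder L] : Prop :=
  ∃ J : Set L, J.OrdConnected ∧ Nonempty (J ≃o ℚ)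

/-! ### Atoms of a measure space -/

/-- `A` is an atom of `μ`: it is measurable, not null, and each measurable subset of `A` is null
or has null complement in `A`. -/
def IsMeasureAtom {Ω : Type*} [MeasurableSpace Ω] (μ : Measure Ω) (A : Set Ω) : Prop :=
  MeasurableSet A ∧ μ A ≠ 0 ∧
    ∀ B : Set Ω, MeasurableSet B → B ⊆ A → μ B = 0 ∨ μ (A \ B) = 0

/-- Two atoms are identified if they differ by a null set. -/
def atomSetoid {Ω : Type*} [MeasurableSpace Ω] (μ : Measure Ω) :
    Setoid {A : Set Ω // IsMeasureAtom μ A} where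
  r A B := (A : Set Ω) =ᵐ[μ] (B : Set Ω)
  iseqv :=
    { refl := fun _ => Filter.EventuallyEq.rfl
      symm := fun h => h.symm
      trans := fun h h' => h.trans h' }

/-- The number of atoms of `μ`, counted up to null sets. -/
noncomputable def numAtoms {Ω : Type*} [MeasurableSpace Ω] (μ : Measure Ω) : ℕ∞ :=
  ENat.card (Quotient (atomSetoid μ))

/-! ### Presentations of Banach spaces and their names -/

/-- A presentation of a Banach space: a sequence of distinguished points whose linear span is
dense. -/
structure Presentation (𝕜 B : Type*) [RCLike 𝕜] [NormedAddCommGroup B] [NormedSpace 𝕜 B] where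
  /-- The `n`-th distinguished point. -/
  point : ℕ → B
  linearlyDense : closure (Submodule.span 𝕜 (Set.range point) : Set B) = Set.univ

/-- Codes of rational scalars: codes of a real and an imaginary part. -/
abbrev ScalarCode : Type := (ℕ × ℕ × ℕ) × (ℕ × ℕ × ℕ)

/-- The rational scalar with a given code. For `𝕜 = ℂ` these are the elements of `ℚ(i)`; for
`𝕜 = ℝ`, where `RCLike.I = 0`, the imaginary part is ignored and these are the rationals. -/
noncomputable def scalarOfCode (𝕜 : Type*) [RCLike 𝕜] (c : ScalarCode) : 𝕜 :=
  ((ratOfCode c.1 : ℚ) : 𝕜) + ((ratOfCode c.2 : ℚ) : 𝕜) * RCLike.I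

/-- The `n`-th open interval with rational centre and positive rational radius. -/
noncomputable def rationalInterval (n : ℕ) : Set ℝ :=
  let q := Denumerable.ofNat ((ℕ × ℕ × ℕ) × (ℕ × ℕ)) n
  Metric.ball (ratOfCode q.1 : ℝ) (((q.2.1 : ℝ) + 1) / ((q.2.2 : ℝ) + 1))

namespace Presentation

variable {𝕜 B : Type*} [RCLike 𝕜] [NormedAddCommGroup B] [NormedSpace 𝕜 B]

/-- The `m`-th rational vector: `m` codes a finite list of rational scalars, the coefficients of
the first distinguished points. -/
noncomputable def rationalVector (P : Presentation 𝕜 B) (m : ℕ) : B :=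
  let l := Denumerable.ofNat (List ScalarCode) m
  ∑ j : Fin l.length, scalarOfCode 𝕜 (l.get j) • P.point j

/-- The diagram of a presentation: the (coded) pairs `(m, n)` such that the norm of the `m`-th
rational vector lies in the `n`-th rational interval. -/
def diagram (P : Presentation 𝕜 B) : Set ℕ :=
  {c | ‖P.rationalVector c.unpair.1‖ ∈ rationalInterval c.unpair.2}

/-- `g` is a name of the presentation `P`: it enumerates the diagram of `P`. -/
def IsName (P : Presentation 𝕜 B) (g : ℕ → ℕ) : Prop := Set.range g = P.diagram

end Presentation

/-- For a real exponent `p ≥ 1`, the space `Lp 𝕜 (ENNReal.ofReal p) μ` is a normed space. -/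
instance fact_one_le_ofReal (p : ℝ) [Fact (1 ≤ p)] : Fact (1 ≤ ENNReal.ofReal p) :=
  ⟨ENNReal.one_le_ofReal.mpr Fact.out⟩

/-! The elements of `L` are placed in `(0, 1)` in the order of their codes: each new one goes to the
midpoint between its nearest neighbours among those already placed, with `0` and `1` as outer ends.
This gives a strictly increasing `h : L → (0, 1)`. The space Ω is the real line with the σ-algebra
generated by the cells `[h a, h b)` and with Lebesgue measure on the union of the cells, a finite
measure.

Atoms: no generator splits the cell of an adjacency, so that cell is an atom. Conversely, midpoint
insertion leaves no other gaps: a cut of `L` whose two sides stay a positive distance apart is an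
adjacency (`gapsAreAdjacencies_position`), because an element inserted later between its sides would
halve the gap. An atom `A` produces such a cut, with gap at least the measure of `A`
(`exists_ae_eq_cell`).

Embedding: an interval isomorphic to `ℚ` has no adjacencies, hence no gaps, so `h` takes a dense set
of values between two of its points. On that cell the σ-algebra contains all initial segments, and
the affine map onto `[0, 1)` induces the isometry (`nonempty_embedding`).

Name: the distinguished point with index `⟨m, n⟩` is the indicator of the cell from `m` to `n` if `f
⟨m, n⟩ = 1`, and `0` otherwise; a π-λ argument gives linear density. A rational vector with `N`
coefficients is constant on the dyadic intervals of length `2⁻ᴺ`, with values in `ℚ(i)` that are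
computed from the first `N²` bits of `f` (`lineValue_eq_cellValue`). So membership of its norm in a
rational interval amounts to strict inequalities between finite sums of `p`-th powers. Such an
inequality holds exactly when it has a finite, checkable witness built from rational bounds and
rational exponents on both sides of `p` (`SumPowLt.sum_lt`, `exists_sumPowLt`). The operator runs
through all pairs of a candidate and a witness; it outputs the candidate if the check succeeds and a
fixed member of every diagram otherwise. -/

/-! ### Arithmetic on codes of rational numbers -/

/-- Codes of rational numbers, see `ratOfCode`. -/
abbrev QCode : Type := ℕ × ℕ × ℕ

namespace QCode

/-- Sum of codes. -/
def add (x y : QCode) : QCode :=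
  (x.1 * (y.2.2 + 1) + y.1 * (x.2.2 + 1), x.2.1 * (y.2.2 + 1) + y.2.1 * (x.2.2 + 1),
    x.2.2 * y.2.2 + x.2.2 + y.2.2)

/-- Product of codes. -/
def mul (x y : QCode) : QCode :=
  (x.1 * y.1 + x.2.1 * y.2.1, x.1 * y.2.1 + x.2.1 * y.1, x.2.2 * y.2.2 + x.2.2 + y.2.2)

/-- Negation of a code. -/
def neg (x : QCode) : QCode := (x.2.1, x.1, x.2.2)

/-- Powers of a code. -/
def pow (x : QCode) (n : ℕ) : QCode := n.rec (1, 0, 0) fun _ z => mul z x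

/-- Sum of a list of codes. -/
def sum (l : List QCode) : QCode := l.foldr add (0, 0, 0)

/-- Comparison of codes. -/
def Lt (x y : QCode) : Prop :=
  x.1 * (y.2.2 + 1) + y.2.1 * (x.2.2 + 1) < y.1 * (x.2.2 + 1) + x.2.1 * (y.2.2 + 1)

instance : DecidableRel Lt := fun _ _ => inferInstanceAs (Decidable (_ < _))

end QCode

theorem ratOfCode_add (x y : QCode) :
    ratOfCode (QCode.add x y) = ratOfCode x + ratOfCode y := by
  have h1 : (x.2.2 : ℚ) + 1 ≠ 0 := by positivity
  have h2 : (y.2.2 : ℚ) + 1 ≠ 0 := by positivity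
  have h3 : (x.2.2 * y.2.2 + x.2.2 + y.2.2 : ℚ) + 1 = (x.2.2 + 1) * (y.2.2 + 1) := by ring
  simp only [ratOfCode, QCode.add]
  push_cast
  rw [h3]
  field_simp
  ring

theorem ratOfCode_mul (x y : QCode) :
    ratOfCode (QCode.mul x y) = ratOfCode x * ratOfCode y := by
  have h1 : (x.2.2 : ℚ) + 1 ≠ 0 := by positivity
  have h2 : (y.2.2 : ℚ) + 1 ≠ 0 := by positivity
  have h3 : (x.2.2 * y.2.2 + x.2.2 + y.2.2 : ℚ) + 1 = (x.2.2 + 1) * (y.2.2 + 1) := by ring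
  simp only [ratOfCode, QCode.mul]
  push_cast
  rw [h3]
  field_simp
  ring

theorem ratOfCode_neg (x : QCode) : ratOfCode (QCode.neg x) = -ratOfCode x := by
  simp only [ratOfCode, QCode.neg]
  ring

theorem ratOfCode_zero : ratOfCode (0, 0, 0) = 0 := by simp [ratOfCode]

theorem ratOfCode_frac (n d : ℕ) : ratOfCode (n, 0, d) = n / (d + 1) := by simp [ratOfCode]

theorem ratOfCode_pow (x : QCode) (n : ℕ) : ratOfCode (QCode.pow x n) = ratOfCode x ^ n := by
  induction n with
  | zero => simp [QCode.pow, ratOfCode]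
  | succ n ih =>
    rw [pow_succ, ← ih, ← ratOfCode_mul]
    rfl

theorem ratOfCode_sum (l : List QCode) :
    ratOfCode (QCode.sum l) = (l.map ratOfCode).sum := by
  induction l with
  | nil => simp [QCode.sum, ratOfCode]
  | cons x l ih =>
    rw [List.map_cons, List.sum_cons, ← ih, ← ratOfCode_add]
    rfl

theorem QCode.lt_iff (x y : QCode) : QCode.Lt x y ↔ ratOfCode x < ratOfCode y := by
  simp only [ratOfCode, QCode.Lt]
  rw [div_lt_div_iff₀ (by positivity) (by positivity), ← Nat.cast_lt (α := ℚ)]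
  push_cast
  constructor <;> intro h <;> linarith

/-! ### Primitive recursiveness of rational arithmetic. -/

section Primrec

variable {α : Type*} [Primcodable α]

theorem Primrec.qcode_add {f g : α → QCode} (hf : Primrec f) (hg : Primrec g) :
    Primrec fun a => QCode.add (f a) (g a) := by
  have f1 := Primrec.fst.comp hf
  have f2 := Primrec.fst.comp (Primrec.snd.comp hf)
  have f3 := Primrec.snd.comp (Primrec.snd.comp hf)
  have g1 := Primrec.fst.comp hg
  have g2 := Primrec.fst.comp (Primrec.snd.comp hg)
  have g3 := Primrec.snd.comp (Primrec.snd.comp hg)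
  have f4 := Primrec.succ.comp f3
  have g4 := Primrec.succ.comp g3
  exact (Primrec.nat_add.comp (Primrec.nat_mul.comp f1 g4) (Primrec.nat_mul.comp g1 f4)).pair
    ((Primrec.nat_add.comp (Primrec.nat_mul.comp f2 g4) (Primrec.nat_mul.comp g2 f4)).pair
    (Primrec.nat_add.comp (Primrec.nat_add.comp (Primrec.nat_mul.comp f3 g3) f3) g3))

theorem Primrec.qcode_mul {f g : α → QCode} (hf : Primrec f) (hg : Primrec g) :
    Primrec fun a => QCode.mul (f a) (g a) := by
  have f1 := Primrec.fst.comp hf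
  have f2 := Primrec.fst.comp (Primrec.snd.comp hf)
  have f3 := Primrec.snd.comp (Primrec.snd.comp hf)
  have g1 := Primrec.fst.comp hg
  have g2 := Primrec.fst.comp (Primrec.snd.comp hg)
  have g3 := Primrec.snd.comp (Primrec.snd.comp hg)
  exact (Primrec.nat_add.comp (Primrec.nat_mul.comp f1 g1) (Primrec.nat_mul.comp f2 g2)).pair
    ((Primrec.nat_add.comp (Primrec.nat_mul.comp f1 g2) (Primrec.nat_mul.comp f2 g1)).pair
    (Primrec.nat_add.comp (Primrec.nat_add.comp (Primrec.nat_mul.comp f3 g3) f3) g3))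

theorem Primrec.qcode_neg {f : α → QCode} (hf : Primrec f) :
    Primrec fun a => QCode.neg (f a) :=
  (Primrec.fst.comp (Primrec.snd.comp hf)).pair
    ((Primrec.fst.comp hf).pair (Primrec.snd.comp (Primrec.snd.comp hf)))

theorem Primrec.qcode_pow {f : α → QCode} {g : α → ℕ} (hf : Primrec f) (hg : Primrec g) :
    Primrec fun a => QCode.pow (f a) (g a) :=
  Primrec.nat_rec' (h := fun a z => QCode.mul z.2 (f a)) hg (Primrec.const _)
    (Primrec.qcode_mul (Primrec.snd.comp Primrec.snd) (hf.comp Primrec.fst)).to₂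

theorem Primrec.qcode_sum {f : α → List QCode} (hf : Primrec f) :
    Primrec fun a => QCode.sum (f a) :=
  Primrec.list_foldr (h := fun _ z => QCode.add z.1 z.2) hf (Primrec.const _)
    (Primrec.qcode_add (Primrec.fst.comp Primrec.snd) (Primrec.snd.comp Primrec.snd)).to₂

theorem PrimrecPred.qcode_lt {f g : α → QCode} (hf : Primrec f) (hg : Primrec g) :
    PrimrecPred fun a => QCode.Lt (f a) (g a) := by
  have f1 := Primrec.fst.comp hf
  have f2 := Primrec.fst.comp (Primrec.snd.comp hf)
  have f4 := Primrec.succ.comp (Primrec.snd.comp (Primrec.snd.comp hf))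
  have g1 := Primrec.fst.comp hg
  have g2 := Primrec.fst.comp (Primrec.snd.comp hg)
  have g4 := Primrec.succ.comp (Primrec.snd.comp (Primrec.snd.comp hg))
  exact Primrec.nat_lt.comp
    (Primrec.nat_add.comp (Primrec.nat_mul.comp f1 g4) (Primrec.nat_mul.comp g2 f4))
    (Primrec.nat_add.comp (Primrec.nat_mul.comp g1 f4) (Primrec.nat_mul.comp f2 g4))

theorem Primrec.qcode_frac {f g : α → ℕ} (hf : Primrec f) (hg : Primrec g) :
    Primrec fun a => ((f a, 0, g a) : QCode) :=
  hf.pair ((Primrec.const 0).pair hg)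

theorem Primrec.two_pow {f : α → ℕ} (hf : Primrec f) : Primrec fun a => 2 ^ f a :=
  (Primrec.nat_rec' (h := fun _ z => 2 * z.2) hf (Primrec.const 1)
    (Primrec.nat_mul.comp (Primrec.const 2) (Primrec.snd.comp Primrec.snd)).to₂).of_eq fun a => by
      induction f a with
      | zero => rfl
      | succ n ih => rw [pow_succ, ← ih, mul_comm]

theorem PrimrecPred.forall_lt' {f : α → ℕ} {P : α → ℕ → Prop} (hf : Primrec f)
    (hP : PrimrecPred fun z : α × ℕ => P z.1 z.2) : PrimrecPred fun a => ∀ i < f a, P a i :=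
  ((PrimrecRel.forall_mem_list (R := fun i a => P a i)
    (hP.comp (Primrec.pair Primrec.snd Primrec.fst))).comp (Primrec.list_range.comp hf)
      Primrec.id).of_eq fun a => by simp

end Primrec

/-! ### Semidecidable comparison of sums of real powers -/

/-- Two fractions `u / (v + 1)` and `u' / (v' + 1)`, used as exponents. -/
abbrev ExpPair : Type := (ℕ × ℕ) × (ℕ × ℕ)

/-- The check that the fractions of `e` are strictly below, resp. above, every real at distance less
than `2⁻ᵏ` from the rational coded by `q`. -/
def Brackets (e : ExpPair) (k : ℕ) (q : QCode) : Prop :=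
  0 < e.1.1 ∧ QCode.Lt (QCode.add (e.1.1, 0, e.1.2) (1, 0, 2 ^ k - 1)) q ∧
    QCode.Lt (QCode.add q (1, 0, 2 ^ k - 1)) (e.2.1, 0, e.2.2)

/-- The check that `√x ^ r < y` for both fractions `r` of `e`. -/
def PowLt (e : ExpPair) (x y : QCode) : Prop :=
  QCode.Lt (QCode.pow x e.1.1) (QCode.pow y (2 * (e.1.2 + 1))) ∧
    QCode.Lt (QCode.pow x e.2.1) (QCode.pow y (2 * (e.2.2 + 1)))

/-- The check that `y < √x ^ r` for both fractions `r` of `e`. -/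
def LtPow (e : ExpPair) (x y : QCode) : Prop :=
  QCode.Lt (QCode.pow y (2 * (e.1.2 + 1))) (QCode.pow x e.1.1) ∧
    QCode.Lt (QCode.pow y (2 * (e.2.2 + 1))) (QCode.pow x e.2.1)

/-- Witnesses for inequalities between sums of powers: a denominator and two lists of numerators. -/
abbrev SumWitness : Type := ℕ × List ℕ × List ℕ

/-- The check, with witness `w`, that the sum of the powers `√x ^ r`, `x` in `xs`, is less than the
sum of the powers `√y ^ r`, `y` in `ys`, whenever `r` lies between the fractions of `e`. -/
def SumPowLt (e : ExpPair) (w : SumWitness) (xs ys : List QCode) : Prop :=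
  (∀ i < xs.length, PowLt e (xs.getD i (0, 0, 0)) (w.2.1.getD i 0, 0, w.1)) ∧
  (∀ i < ys.length, w.2.2.getD i 0 = 0 ∨
    LtPow e (ys.getD i (0, 0, 0)) (w.2.2.getD i 0, 0, w.1)) ∧
  ((List.range xs.length).map fun i => w.2.1.getD i 0).foldr (· + ·) 0 ≤
    ((List.range ys.length).map fun i => w.2.2.getD i 0).foldr (· + ·) 0

/-! ### Primitive recursiveness of the comparison of sums of powers. -/

section Primrec

variable {α : Type*} [Primcodable α]

theorem PrimrecPred.brackets {e : α → ExpPair} {k : α → ℕ} {q : α → QCode} (he : Primrec e)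
    (hk : Primrec k) (hq : Primrec q) : PrimrecPred fun a => Brackets (e a) (k a) (q a) := by
  have h1 := Primrec.fst.comp (Primrec.fst.comp he)
  have h2 := Primrec.snd.comp (Primrec.fst.comp he)
  have h3 := Primrec.fst.comp (Primrec.snd.comp he)
  have h4 := Primrec.snd.comp (Primrec.snd.comp he)
  have h5 : Primrec fun a => ((1, 0, 2 ^ k a - 1) : QCode) :=
    Primrec.qcode_frac (Primrec.const 1) (Primrec.nat_sub.comp (Primrec.two_pow hk)
      (Primrec.const 1))
  exact (Primrec.nat_lt.comp (Primrec.const 0) h1).and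
    ((PrimrecPred.qcode_lt (Primrec.qcode_add (Primrec.qcode_frac h1 h2) h5) hq).and
    (PrimrecPred.qcode_lt (Primrec.qcode_add hq h5) (Primrec.qcode_frac h3 h4)))

theorem Primrec.two_mul_succ {f : α → ℕ} (hf : Primrec f) : Primrec fun a => 2 * (f a + 1) :=
  Primrec.nat_mul.comp (Primrec.const 2) (Primrec.succ.comp hf)

theorem PrimrecPred.powLt {e : α → ExpPair} {x y : α → QCode} (he : Primrec e)
    (hx : Primrec x) (hy : Primrec y) : PrimrecPred fun a => PowLt (e a) (x a) (y a) := by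
  have h1 := Primrec.fst.comp (Primrec.fst.comp he)
  have h2 := Primrec.two_mul_succ (Primrec.snd.comp (Primrec.fst.comp he))
  have h3 := Primrec.fst.comp (Primrec.snd.comp he)
  have h4 := Primrec.two_mul_succ (Primrec.snd.comp (Primrec.snd.comp he))
  exact (PrimrecPred.qcode_lt (Primrec.qcode_pow hx h1) (Primrec.qcode_pow hy h2)).and
    (PrimrecPred.qcode_lt (Primrec.qcode_pow hx h3) (Primrec.qcode_pow hy h4))

theorem PrimrecPred.ltPow {e : α → ExpPair} {x y : α → QCode} (he : Primrec e)
    (hx : Primrec x) (hy : Primrec y) : PrimrecPred fun a => LtPow (e a) (x a) (y a) := by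
  have h1 := Primrec.fst.comp (Primrec.fst.comp he)
  have h2 := Primrec.two_mul_succ (Primrec.snd.comp (Primrec.fst.comp he))
  have h3 := Primrec.fst.comp (Primrec.snd.comp he)
  have h4 := Primrec.two_mul_succ (Primrec.snd.comp (Primrec.snd.comp he))
  exact (PrimrecPred.qcode_lt (Primrec.qcode_pow hy h2) (Primrec.qcode_pow hx h1)).and
    (PrimrecPred.qcode_lt (Primrec.qcode_pow hy h4) (Primrec.qcode_pow hx h3))

theorem Primrec.sum_getD {f : α → ℕ} {g : α → List ℕ} (hf : Primrec f) (hg : Primrec g) :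
    Primrec fun a => ((List.range (f a)).map fun i => (g a).getD i 0).foldr (· + ·) 0 :=
  Primrec.list_foldr (h := fun _ z => z.1 + z.2)
    (Primrec.list_map (Primrec.list_range.comp hf)
      ((Primrec.list_getD 0).comp (hg.comp Primrec.fst) Primrec.snd).to₂) (Primrec.const 0)
    (Primrec.nat_add.comp (Primrec.fst.comp Primrec.snd) (Primrec.snd.comp Primrec.snd)).to₂

theorem PrimrecPred.sumPowLt {e : α → ExpPair} {w : α → SumWitness} {x y : α → List QCode}
    (he : Primrec e) (hw : Primrec w) (hx : Primrec x) (hy : Primrec y) :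
    PrimrecPred fun a => SumPowLt (e a) (w a) (x a) (y a) := by
  have w1 := Primrec.fst.comp hw
  have w2 := Primrec.fst.comp (Primrec.snd.comp hw)
  have w3 := Primrec.snd.comp (Primrec.snd.comp hw)
  have g2 := (Primrec.list_getD 0).comp (w2.comp (Primrec.fst (β := ℕ))) Primrec.snd
  have g3 := (Primrec.list_getD 0).comp (w3.comp (Primrec.fst (β := ℕ))) Primrec.snd
  refine PrimrecPred.and (PrimrecPred.forall_lt' (Primrec.list_length.comp hx) ?_)
    (PrimrecPred.and (PrimrecPred.forall_lt' (Primrec.list_length.comp hy) ?_) ?_)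
  · exact PrimrecPred.powLt (he.comp Primrec.fst)
      ((Primrec.list_getD (0, 0, 0)).comp (hx.comp Primrec.fst) Primrec.snd)
      (Primrec.qcode_frac g2 (w1.comp Primrec.fst))
  · exact PrimrecPred.or (Primrec.eq.comp g3 (Primrec.const 0))
      (PrimrecPred.ltPow (he.comp Primrec.fst)
      ((Primrec.list_getD (0, 0, 0)).comp (hy.comp Primrec.fst) Primrec.snd)
      (Primrec.qcode_frac g3 (w1.comp Primrec.fst)))
  · exact Primrec.nat_le.comp (Primrec.sum_getD (Primrec.list_length.comp hx) w2)
      (Primrec.sum_getD (Primrec.list_length.comp hy) w3)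

end Primrec

/-! ### The positions of the elements and the values of rational vectors -/

/-- Largest entry `x j` with `j` below `n` in the order coded by `s`; default `0`. -/
def lowerNeighbor (s : List Bool) (n : ℕ) (x : List ℕ) : ℕ :=
  (List.range n).foldr
    (fun j z => if s.getD (Nat.pair j n) false = true then max (x.getD j 0) z else z) 0

/-- Smallest entry `x j` with `j` above `n` in the order coded by `s`; default `2ⁿ`. -/
def upperNeighbor (s : List Bool) (n : ℕ) (x : List ℕ) : ℕ :=
  (List.range n).foldr
    (fun j z => if s.getD (Nat.pair n j) false = true then min (x.getD j 0) z else z) (2 ^ n)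

/-- The positions of the numbers `j < n`, multiplied by `2ⁿ`: each new element is put in the middle
between its neighbours. -/
def positions (s : List Bool) (n : ℕ) : List ℕ :=
  n.rec [] fun n x => x.map (2 * ·) ++ [lowerNeighbor s n x + upperNeighbor s n x]

/-- Whether the `i`-th cell of length `2⁻ᴺ` is contained in the support of the `j`-th distinguished
point; `x` is the list of positions multiplied by `2ᴺ`. -/
def CellMem (s : List Bool) (x : List ℕ) (i j : ℕ) : Prop :=
  s.getD j false = true ∧ x.getD j.unpair.1 0 ≤ i ∧ i < x.getD j.unpair.2 0

instance (s : List Bool) (x : List ℕ) (i j : ℕ) : Decidable (CellMem s x i j) :=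
  inferInstanceAs (Decidable (_ ∧ _))

/-- Real part of the value on the `i`-th cell of the vector with coefficients `l`. -/
def cellRe (s : List Bool) (x : List ℕ) (l : List ScalarCode) (i : ℕ) : QCode :=
  QCode.sum ((List.range l.length).map fun j =>
    if CellMem s x i j then (l.getD j ((0, 0, 0), (0, 0, 0))).1 else (0, 0, 0))

/-- Imaginary part of the value on the `i`-th cell of the vector with coefficients `l`. -/
def cellIm (s : List Bool) (x : List ℕ) (l : List ScalarCode) (i : ℕ) : QCode :=
  QCode.sum ((List.range l.length).map fun j =>
    if CellMem s x i j then (l.getD j ((0, 0, 0), (0, 0, 0))).2 else (0, 0, 0))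

/-- Squared modulus of the value on the `i`-th cell of the vector with coefficients `l`; here `δ`
codes `|i|²`. -/
def cellNormSq (δ : QCode) (s : List Bool) (x : List ℕ) (l : List ScalarCode) (i : ℕ) : QCode :=
  QCode.add (QCode.mul (cellRe s x l i) (cellRe s x l i))
    (QCode.mul δ (QCode.mul (cellIm s x l i) (cellIm s x l i)))

/-- Squared moduli of the values on the cells of the vector with coefficients `l`. -/
def cellNormSqs (δ : QCode) (s : List Bool) (l : List ScalarCode) : List QCode :=
  (List.range (2 ^ l.length)).map fun i => cellNormSq δ s (positions s l.length) l i

/-- The constant list with as many entries as there are cells. -/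
def cellConst (x : QCode) (l : List ScalarCode) : List QCode :=
  (List.range (2 ^ l.length)).map fun _ => x

/-- Witnesses for membership in the diagram. -/
abbrev DiagramWitness : Type := (ExpPair × ℕ) × SumWitness × SumWitness

/-- Decoding of rational intervals: centre and numbers coding the radius. -/
def intervalCode (n : ℕ) : QCode × (ℕ × ℕ) := Denumerable.ofNat ((ℕ × ℕ × ℕ) × (ℕ × ℕ)) n

/-- Right end of a rational interval. -/
def rightEnd (n : ℕ) : QCode :=
  QCode.add (intervalCode n).1 ((intervalCode n).2.1 + 1, 0, (intervalCode n).2.2)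

/-- Left end of a rational interval. -/
def leftEnd (n : ℕ) : QCode :=
  QCode.add (intervalCode n).1 (QCode.neg ((intervalCode n).2.1 + 1, 0, (intervalCode n).2.2))

/-- The list of coefficients of a rational vector. -/
def coefficients (m : ℕ) : List ScalarCode := Denumerable.ofNat (List ScalarCode) m

/-- The check, with witness `w`, that the `c`-th pair is in the diagram of the presentation; `q` is
an approximation of the exponent. -/
def DiagramCheck (δ : QCode) (s : List Bool) (c : ℕ) (w : DiagramWitness) (q : QCode) : Prop :=
  Brackets w.1.1 w.1.2 q ∧
  (QCode.Lt (0, 0, 0) (rightEnd c.unpair.2) ∧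
    SumPowLt w.1.1 w.2.1 (cellNormSqs δ s (coefficients c.unpair.1))
      (cellConst (QCode.mul (rightEnd c.unpair.2) (rightEnd c.unpair.2))
        (coefficients c.unpair.1))) ∧
  (QCode.Lt (leftEnd c.unpair.2) (0, 0, 0) ∨
    SumPowLt w.1.1 w.2.2 (cellConst (QCode.mul (leftEnd c.unpair.2) (leftEnd c.unpair.2))
        (coefficients c.unpair.1))
      (cellNormSqs δ s (coefficients c.unpair.1)))

/-! ### Primitive recursiveness of the positions and of the diagram check. -/

section Primrec

variable {α : Type*} [Primcodable α]

theorem Primrec.list_getD_comp {β : Type*} [Primcodable β] (d : β) {l : α → List β} {n : α → ℕ}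
    (hl : Primrec l) (hn : Primrec n) : Primrec fun a => (l a).getD (n a) d :=
  (Primrec.list_getD d).comp hl hn

theorem PrimrecPred.getD_eq_true {s : α → List Bool} {n : α → ℕ}
    (hs : Primrec s) (hn : Primrec n) : PrimrecPred fun a => (s a).getD (n a) false = true :=
  Primrec.eq.comp (Primrec.list_getD_comp false hs hn) (Primrec.const true)

theorem Primrec.lowerNeighbor {s : α → List Bool} {n : α → ℕ} {x : α → List ℕ}
    (hs : Primrec s) (hn : Primrec n) (hx : Primrec x) :
    Primrec fun a => lowerNeighbor (s a) (n a) (x a) :=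
  Primrec.list_foldr (h := fun a z =>
      if (s a).getD (Nat.pair z.1 (n a)) false = true then max ((x a).getD z.1 0) z.2 else z.2)
    (Primrec.list_range.comp hn) (Primrec.const 0)
    (Primrec.ite (PrimrecPred.getD_eq_true (hs.comp Primrec.fst)
        (Primrec₂.natPair.comp (Primrec.fst.comp Primrec.snd) (hn.comp Primrec.fst)))
      (Primrec.nat_max.comp (Primrec.list_getD_comp 0 (hx.comp Primrec.fst)
        (Primrec.fst.comp Primrec.snd)) (Primrec.snd.comp Primrec.snd))
      (Primrec.snd.comp Primrec.snd)).to₂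

theorem Primrec.upperNeighbor {s : α → List Bool} {n : α → ℕ} {x : α → List ℕ}
    (hs : Primrec s) (hn : Primrec n) (hx : Primrec x) :
    Primrec fun a => upperNeighbor (s a) (n a) (x a) :=
  Primrec.list_foldr (h := fun a z =>
      if (s a).getD (Nat.pair (n a) z.1) false = true then min ((x a).getD z.1 0) z.2 else z.2)
    (Primrec.list_range.comp hn) (Primrec.two_pow hn)
    (Primrec.ite (PrimrecPred.getD_eq_true (hs.comp Primrec.fst)
        (Primrec₂.natPair.comp (hn.comp Primrec.fst) (Primrec.fst.comp Primrec.snd)))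
      (Primrec.nat_min.comp (Primrec.list_getD_comp 0 (hx.comp Primrec.fst)
        (Primrec.fst.comp Primrec.snd)) (Primrec.snd.comp Primrec.snd))
      (Primrec.snd.comp Primrec.snd)).to₂

theorem Primrec.positions {s : α → List Bool} {n : α → ℕ} (hs : Primrec s) (hn : Primrec n) :
    Primrec fun a => positions (s a) (n a) :=
  have h1 : Primrec fun z : α × ℕ × List ℕ => s z.1 := hs.comp Primrec.fst
  have h2 : Primrec fun z : α × ℕ × List ℕ => z.2.1 := Primrec.fst.comp Primrec.snd
  have h3 : Primrec fun z : α × ℕ × List ℕ => z.2.2 := Primrec.snd.comp Primrec.snd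
  Primrec.nat_rec' (h := fun a z => z.2.map (2 * ·) ++
      [_root_.lowerNeighbor (s a) z.1 z.2 + _root_.upperNeighbor (s a) z.1 z.2])
    hn (Primrec.const [])
    (Primrec.list_concat.comp (Primrec.list_map h3
      (Primrec.nat_mul.comp (Primrec.const 2) Primrec.snd).to₂)
      (Primrec.nat_add.comp (Primrec.lowerNeighbor h1 h2 h3) (Primrec.upperNeighbor h1 h2 h3))).to₂

theorem PrimrecPred.cellMem {s : α → List Bool} {x : α → List ℕ} {i j : α → ℕ}
    (hs : Primrec s) (hx : Primrec x) (hi : Primrec i) (hj : Primrec j) :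
    PrimrecPred fun a => CellMem (s a) (x a) (i a) (j a) :=
  (PrimrecPred.getD_eq_true hs hj).and ((Primrec.nat_le.comp (Primrec.list_getD_comp 0 hx
    (Primrec.fst.comp (Primrec.unpair.comp hj))) hi).and
    (Primrec.nat_lt.comp hi (Primrec.list_getD_comp 0 hx
    (Primrec.snd.comp (Primrec.unpair.comp hj)))))

theorem Primrec.cellNormSq {δ : QCode} {s : α → List Bool} {x : α → List ℕ}
    {l : α → List ScalarCode} {i : α → ℕ} (hs : Primrec s) (hx : Primrec x) (hl : Primrec l)
    (hi : Primrec i) : Primrec fun a => cellNormSq δ (s a) (x a) (l a) (i a) := by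
  have h1 : PrimrecPred fun z : α × ℕ => CellMem (s z.1) (x z.1) (i z.1) z.2 :=
    PrimrecPred.cellMem (hs.comp Primrec.fst) (hx.comp Primrec.fst) (hi.comp Primrec.fst)
      Primrec.snd
  have h2 : Primrec fun z : α × ℕ => (l z.1).getD z.2 ((0, 0, 0), (0, 0, 0)) :=
    Primrec.list_getD_comp _ (hl.comp Primrec.fst) Primrec.snd
  have h3 := Primrec.list_range.comp (Primrec.list_length.comp hl)
  have hre : Primrec fun a => cellRe (s a) (x a) (l a) (i a) :=
    Primrec.qcode_sum (Primrec.list_map h3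
      (Primrec.ite h1 (Primrec.fst.comp h2) (Primrec.const _)).to₂)
  have him : Primrec fun a => cellIm (s a) (x a) (l a) (i a) :=
    Primrec.qcode_sum (Primrec.list_map h3
      (Primrec.ite h1 (Primrec.snd.comp h2) (Primrec.const _)).to₂)
  exact Primrec.qcode_add (Primrec.qcode_mul hre hre)
    (Primrec.qcode_mul (Primrec.const _) (Primrec.qcode_mul him him))

theorem Primrec.cellNormSqs {δ : QCode} {s : α → List Bool} {l : α → List ScalarCode}
    (hs : Primrec s) (hl : Primrec l) : Primrec fun a => cellNormSqs δ (s a) (l a) :=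
  Primrec.list_map (Primrec.list_range.comp (Primrec.two_pow (Primrec.list_length.comp hl)))
    (Primrec.cellNormSq (hs.comp Primrec.fst)
      ((Primrec.positions hs (Primrec.list_length.comp hl)).comp Primrec.fst)
      (hl.comp Primrec.fst) Primrec.snd).to₂

theorem Primrec.cellConst {x : α → QCode} {l : α → List ScalarCode}
    (hx : Primrec x) (hl : Primrec l) : Primrec fun a => cellConst (x a) (l a) :=
  Primrec.list_map (Primrec.list_range.comp (Primrec.two_pow (Primrec.list_length.comp hl)))
    (hx.comp Primrec.fst).to₂

theorem primrec_intervalCode : Primrec intervalCode :=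
  Primrec.ofNat ((ℕ × ℕ × ℕ) × (ℕ × ℕ))

theorem primrec_coefficients : Primrec coefficients := Primrec.ofNat (List ScalarCode)

theorem primrec_radius :
    Primrec fun n => (((intervalCode n).2.1 + 1, 0, (intervalCode n).2.2) : QCode) :=
  Primrec.qcode_frac (Primrec.succ.comp (Primrec.fst.comp (Primrec.snd.comp primrec_intervalCode)))
    (Primrec.snd.comp (Primrec.snd.comp primrec_intervalCode))

theorem primrec_rightEnd : Primrec rightEnd :=
  Primrec.qcode_add (Primrec.fst.comp primrec_intervalCode) primrec_radius

theorem primrec_leftEnd : Primrec leftEnd :=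
  Primrec.qcode_add (Primrec.fst.comp primrec_intervalCode) (Primrec.qcode_neg primrec_radius)

theorem PrimrecPred.diagramCheck {δ : QCode} {s : α → List Bool} {c : α → ℕ}
    {w : α → DiagramWitness} {q : α → QCode} (hs : Primrec s) (hc : Primrec c) (hw : Primrec w)
    (hq : Primrec q) : PrimrecPred fun a => DiagramCheck δ (s a) (c a) (w a) (q a) := by
  have he := Primrec.fst.comp (Primrec.fst.comp hw)
  have hk := Primrec.snd.comp (Primrec.fst.comp hw)
  have hw1 := Primrec.fst.comp (Primrec.snd.comp hw)
  have hw2 := Primrec.snd.comp (Primrec.snd.comp hw)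
  have hl := primrec_coefficients.comp (Primrec.fst.comp (Primrec.unpair.comp hc))
  have hn := Primrec.snd.comp (Primrec.unpair.comp hc)
  have hr := primrec_rightEnd.comp hn
  have hl' := primrec_leftEnd.comp hn
  have hcell := Primrec.cellNormSqs (δ := δ) hs hl
  exact (PrimrecPred.brackets he hk hq).and
    (((PrimrecPred.qcode_lt (Primrec.const _) hr).and
      (PrimrecPred.sumPowLt he hw1 hcell (Primrec.cellConst (Primrec.qcode_mul hr hr) hl))).and
    ((PrimrecPred.qcode_lt hl' (Primrec.const _)).or
      (PrimrecPred.sumPowLt he hw2 (Primrec.cellConst (Primrec.qcode_mul hl' hl') hl) hcell)))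

end Primrec

/-! ### The operator -/

/-- Numbers as pairs of a code of a pair and a witness. -/
def queryCode (n : ℕ) : ℕ × DiagramWitness :=
  (Encodable.decode (α := ℕ × DiagramWitness) n).getD default

/-- The number of bits of the oracle that are used at argument `n`. -/
def queryBound (n : ℕ) : ℕ :=
  (coefficients (queryCode n).1.unpair.1).length * (coefficients (queryCode n).1.unpair.1).length

/-- A code of a pair which is in every diagram: the zero vector and the interval `(-1, 1)`. -/
def trivialPair : ℕ := Nat.pair 0 (Encodable.encode (((0, 0, 0), (0, 0)) : QCode × (ℕ × ℕ)))

open Classical in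
/-- The value of the operator at `n`, from a finite part of the oracle. -/
noncomputable def operatorStep (δ : QCode) (q : ℕ → QCode) (s : List Bool) (n : ℕ) : ℕ :=
  if DiagramCheck δ s (queryCode n).1 (queryCode n).2 (q (queryCode n).2.1.2) then
    (queryCode n).1 else trivialPair

/-- The operator which enumerates the diagram. -/
noncomputable def diagramOperator (δ : QCode) (q : ℕ → QCode) (f : ℕ → Bool) (n : ℕ) : ℕ :=
  operatorStep δ q (initialSegment f (queryBound n)) n

theorem primrec_queryCode : Primrec queryCode :=
  Primrec.option_getD.comp Primrec.decode (Primrec.const default)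

theorem queryCode_surjective : Function.Surjective queryCode := fun a =>
  ⟨Encodable.encode a, by rw [queryCode, Encodable.encodek]; rfl⟩

attribute [irreducible] queryCode

theorem primrec_queryBound : Primrec queryBound :=
  have h := Primrec.list_length.comp (primrec_coefficients.comp
    (Primrec.fst.comp (Primrec.unpair.comp (Primrec.fst.comp primrec_queryCode))))
  Primrec.nat_mul.comp h h

/-- The approximation `q` of the exponent is the only ingredient not known to be primitive
recursive. Passing its value to the check as an argument keeps everything else primitive recursive.
-/
theorem computable_operatorStep (δ : QCode) {q : ℕ → QCode} (hq : Computable q) :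
    Computable₂ (operatorStep δ q) := by
  classical
  have h : Primrec fun z : (List Bool × ℕ) × QCode =>
      if DiagramCheck δ z.1.1 (queryCode z.1.2).1 (queryCode z.1.2).2 z.2 then
        (queryCode z.1.2).1 else trivialPair := by
    have h1 : Primrec fun z : (List Bool × ℕ) × QCode => queryCode z.1.2 :=
      primrec_queryCode.comp (Primrec.snd.comp Primrec.fst)
    exact Primrec.ite (PrimrecPred.diagramCheck (Primrec.fst.comp Primrec.fst)
      (Primrec.fst.comp h1) (Primrec.snd.comp h1) Primrec.snd) (Primrec.fst.comp h1)
      (Primrec.const _)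
  have h2 : Computable fun z : List Bool × ℕ => q (queryCode z.2).2.1.2 :=
    hq.comp (Primrec.to_comp (Primrec.snd.comp (Primrec.fst.comp (Primrec.snd.comp
      (primrec_queryCode.comp Primrec.snd)))))
  exact (h.to_comp.comp (Computable.id.pair h2)).to₂

/-- The algorithm answers once it has `queryBound n` bits and truncates longer strings to that
length, so its answer does not depend on how much of the oracle it has seen. -/
theorem isComputableOperator_diagramOperator (δ : QCode) {q : ℕ → QCode} (hq : Computable q) :
    IsComputableOperator (diagramOperator δ q) := by
  refine ⟨fun s n => if queryBound n ≤ s.length then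
    some (operatorStep δ q (s.take (queryBound n)) n) else none, ?_, fun f n => ⟨?_, ?_⟩⟩
  · have h1 : Primrec fun z : List Bool × ℕ => queryBound z.2 :=
      primrec_queryBound.comp Primrec.snd
    have h2 : Computable fun z : List Bool × ℕ =>
        operatorStep δ q (z.1.take (queryBound z.2)) z.2 :=
      (computable_operatorStep δ hq).comp
        (Primrec.list_take.comp h1 Primrec.fst).to_comp Computable.snd
    have h3 : Primrec fun z : List Bool × ℕ => decide (queryBound z.2 ≤ z.1.length) :=
      (Primrec.nat_le.comp h1 (Primrec.list_length.comp Primrec.fst)).decide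
    refine (Computable.cond h3.to_comp (Computable.option_some.comp h2)
      (Computable.const none)).of_eq fun z => ?_
    by_cases h : queryBound z.2 ≤ z.1.length <;> simp [h]
  · have h : (initialSegment f (queryBound n)).length = queryBound n := by simp [initialSegment]
    refine ⟨queryBound n, ?_⟩
    dsimp only
    rw [if_pos h.ge, List.take_of_length_le h.le, diagramOperator]
  · intro k m h
    have hlen : (initialSegment f k).length = k := by simp [initialSegment]
    dsimp only at h
    rw [hlen] at h
    split_ifs at h with hk
    have key : (initialSegment f k).take (queryBound n) = initialSegment f (queryBound n) := by
      simp [initialSegment, ← List.map_take, List.take_range, hk]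
    rw [key, Option.some_inj] at h
    exact h.symm

/-! ### Correctness of the comparison of sums of powers -/

theorem Brackets.bounds {e : ExpPair} {k : ℕ} {q : QCode} {p : ℝ} (h : Brackets e k q)
    (hp : |p - (ratOfCode q : ℝ)| < (1 / 2 : ℝ) ^ k) :
    0 < e.1.1 ∧ ((e.1.1 / (e.1.2 + 1) : ℚ) : ℝ) < p ∧ p < ((e.2.1 / (e.2.2 + 1) : ℚ) : ℝ) := by
  obtain ⟨h0, h1, h2⟩ := h
  have hk : ratOfCode (1, 0, 2 ^ k - 1) = (1 / 2) ^ k := by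
    rw [ratOfCode_frac, Nat.cast_sub Nat.one_le_two_pow]
    simp
  rw [QCode.lt_iff, ratOfCode_add, hk, ratOfCode_frac] at h1 h2
  have h1' := (Rat.cast_lt (K := ℝ)).2 h1
  have h2' := (Rat.cast_lt (K := ℝ)).2 h2
  push_cast at h1' h2' ⊢
  rw [abs_lt] at hp
  exact ⟨h0, by linarith, by linarith⟩

/-- Raising to the power `2 * (v + 1)` clears the denominator of the exponent. The factor `2` is
there because only the square of a modulus is known to be rational. -/
theorem pow_lt_pow_iff_rpow_lt {a y : ℝ} (ha : 0 ≤ a) (hy : 0 ≤ y) (u v : ℕ) :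
    (a ^ 2) ^ u < y ^ (2 * (v + 1)) ↔ a ^ ((u : ℝ) / (v + 1)) < y := by
  have h1 : (a ^ 2) ^ u = (a ^ ((u : ℝ) / (v + 1))) ^ (2 * (v + 1)) := by
    rw [← Real.rpow_natCast (a ^ ((u : ℝ) / (v + 1))), ← Real.rpow_mul ha, ← pow_mul,
      ← Real.rpow_natCast]
    congr 1
    push_cast
    field_simp
  rw [h1, pow_lt_pow_iff_left₀ (Real.rpow_nonneg ha _) hy (by omega)]

theorem pow_lt_pow_iff_lt_rpow {a y : ℝ} (ha : 0 ≤ a) (hy : 0 ≤ y) (u v : ℕ) :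
    y ^ (2 * (v + 1)) < (a ^ 2) ^ u ↔ y < a ^ ((u : ℝ) / (v + 1)) := by
  have h1 : (a ^ 2) ^ u = (a ^ ((u : ℝ) / (v + 1))) ^ (2 * (v + 1)) := by
    rw [← Real.rpow_natCast (a ^ ((u : ℝ) / (v + 1))), ← Real.rpow_mul ha, ← pow_mul,
      ← Real.rpow_natCast]
    congr 1
    push_cast
    field_simp
  rw [h1, pow_lt_pow_iff_left₀ hy (Real.rpow_nonneg ha _) (by omega)]

theorem powLt_iff {e : ExpPair} {x : QCode} {a : ℝ} (ha : 0 ≤ a)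
    (hx : (ratOfCode x : ℝ) = a ^ 2) (n d : ℕ) :
    PowLt e x (n, 0, d) ↔ a ^ ((e.1.1 / (e.1.2 + 1) : ℚ) : ℝ) < (n : ℝ) / (d + 1) ∧
      a ^ ((e.2.1 / (e.2.2 + 1) : ℚ) : ℝ) < (n : ℝ) / (d + 1) := by
  have hy : (0 : ℝ) ≤ (n : ℝ) / (d + 1) := by positivity
  simp only [PowLt, QCode.lt_iff, ratOfCode_pow, ratOfCode_frac, ← Rat.cast_lt (K := ℝ)]
  push_cast
  rw [hx, pow_lt_pow_iff_rpow_lt ha hy, pow_lt_pow_iff_rpow_lt ha hy]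

theorem ltPow_iff {e : ExpPair} {x : QCode} {a : ℝ} (ha : 0 ≤ a)
    (hx : (ratOfCode x : ℝ) = a ^ 2) (n d : ℕ) :
    LtPow e x (n, 0, d) ↔ (n : ℝ) / (d + 1) < a ^ ((e.1.1 / (e.1.2 + 1) : ℚ) : ℝ) ∧
      (n : ℝ) / (d + 1) < a ^ ((e.2.1 / (e.2.2 + 1) : ℚ) : ℝ) := by
  have hy : (0 : ℝ) ≤ (n : ℝ) / (d + 1) := by positivity
  simp only [LtPow, QCode.lt_iff, ratOfCode_pow, ratOfCode_frac, ← Rat.cast_lt (K := ℝ)]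
  push_cast
  rw [hx, pow_lt_pow_iff_lt_rpow ha hy, pow_lt_pow_iff_lt_rpow ha hy]

/-- The power is antitone in the exponent for `0 < a ≤ 1` and monotone for `a ≥ 1`, so a bound at
both ends covers every exponent in between. For `a = 0` positivity of `r` makes the powers vanish.
-/
theorem Real.rpow_lt_of_between {a y p r s : ℝ} (ha : 0 ≤ a) (hr : 0 < r) (h1 : r < p)
    (h2 : p < s) (hr' : a ^ r < y) (hs : a ^ s < y) : a ^ p < y := by
  rcases ha.eq_or_lt with rfl | ha
  · rwa [Real.zero_rpow (by linarith), ← Real.zero_rpow hr.ne']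
  rcases le_total a 1 with h | h
  · exact (Real.rpow_le_rpow_of_exponent_ge ha h h1.le).trans_lt hr'
  · exact (Real.rpow_le_rpow_of_exponent_le h h2.le).trans_lt hs

theorem Real.lt_rpow_of_between {a y p r s : ℝ} (ha : 0 ≤ a) (hr : 0 < r) (h1 : r < p)
    (h2 : p < s) (hr' : y < a ^ r) (hs : y < a ^ s) : y < a ^ p := by
  rcases ha.eq_or_lt with rfl | ha
  · rwa [Real.zero_rpow (by linarith), ← Real.zero_rpow hr.ne']
  rcases le_total a 1 with h | h
  · exact hs.trans_le (Real.rpow_le_rpow_of_exponent_ge ha h h2.le)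
  · exact hr'.trans_le (Real.rpow_le_rpow_of_exponent_le h h1.le)

theorem foldr_add_map_range (n : ℕ) (f : ℕ → ℕ) :
    ((List.range n).map f).foldr (· + ·) 0 = ∑ i ∈ Finset.range n, f i := by
  rw [← List.sum_eq_foldr]
  induction n with
  | zero => simp
  | succ n ih => simp [List.range_succ, Finset.sum_range_succ, ih]

/-- Soundness of the witness: fractions with a common denominator separate the sums termwise. Only
the upper bounds need be strict, which suffices because `N > 0`; a zero numerator serves where a
power has no positive lower bound. -/
theorem SumPowLt.sum_lt {e : ExpPair} {w : SumWitness} {xs ys : List QCode} {N : ℕ} {p : ℝ}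
    {a b : ℕ → ℝ} (h : SumPowLt e w xs ys) (hN : 0 < N) (hx : xs.length = N) (hy : ys.length = N)
    (ha : ∀ i, 0 ≤ a i) (hb : ∀ i, 0 ≤ b i)
    (hxa : ∀ i < N, (ratOfCode (xs.getD i (0, 0, 0)) : ℝ) = a i ^ 2)
    (hyb : ∀ i < N, (ratOfCode (ys.getD i (0, 0, 0)) : ℝ) = b i ^ 2)
    (h0 : 0 < e.1.1) (h1 : ((e.1.1 / (e.1.2 + 1) : ℚ) : ℝ) < p)
    (h2 : p < ((e.2.1 / (e.2.2 + 1) : ℚ) : ℝ)) :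
    ∑ i ∈ Finset.range N, a i ^ p < ∑ i ∈ Finset.range N, b i ^ p := by
  obtain ⟨hA, hB, hS⟩ := h
  have hr : (0 : ℝ) < ((e.1.1 / (e.1.2 + 1) : ℚ) : ℝ) := by
    push_cast
    have : (0 : ℝ) < e.1.1 := by exact_mod_cast h0
    positivity
  rw [foldr_add_map_range, foldr_add_map_range, hx, hy] at hS
  rw [hx] at hA
  rw [hy] at hB
  calc ∑ i ∈ Finset.range N, a i ^ p
      < ∑ i ∈ Finset.range N, ((w.2.1.getD i 0 : ℕ) : ℝ) / (w.1 + 1) := by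
        refine Finset.sum_lt_sum_of_nonempty (by simpa using hN.ne') fun i hi => ?_
        rw [Finset.mem_range] at hi
        obtain ⟨h3, h4⟩ := (powLt_iff (ha i) (hxa i hi) _ _).1 (hA i hi)
        exact Real.rpow_lt_of_between (ha i) hr h1 h2 h3 h4
    _ = ((∑ i ∈ Finset.range N, w.2.1.getD i 0 : ℕ) : ℝ) / (w.1 + 1) := by
        push_cast
        rw [Finset.sum_div]
    _ ≤ ((∑ i ∈ Finset.range N, w.2.2.getD i 0 : ℕ) : ℝ) / (w.1 + 1) := by gcongr
    _ = ∑ i ∈ Finset.range N, ((w.2.2.getD i 0 : ℕ) : ℝ) / (w.1 + 1) := by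
        push_cast
        rw [Finset.sum_div]
    _ ≤ ∑ i ∈ Finset.range N, b i ^ p := by
        refine Finset.sum_le_sum fun i hi => ?_
        rw [Finset.mem_range] at hi
        rcases hB i hi with h | h
        · rw [h]
          simpa using Real.rpow_nonneg (hb i) p
        · obtain ⟨h3, h4⟩ := (ltPow_iff (hb i) (hyb i hi) _ _).1 h
          exact (Real.lt_rpow_of_between (hb i) hr h1 h2 h3 h4).le

/-- Rational approximations which separate two sums. -/
theorem exists_nat_approx {N : ℕ} {x y : ℕ → ℝ} (hx : ∀ i, 0 ≤ x i)
    (h : ∑ i ∈ Finset.range N, x i < ∑ i ∈ Finset.range N, y i) :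
    ∃ (d : ℕ) (m n : ℕ → ℕ), (∀ i, x i < (m i : ℝ) / (d + 1)) ∧
      (∀ i, n i = 0 ∨ (n i : ℝ) / (d + 1) < y i) ∧
      ∑ i ∈ Finset.range N, m i ≤ ∑ i ∈ Finset.range N, n i := by
  -- Rounding costs at most `1` per term, so at most `N` in each sum; the difference of the sums,
  -- scaled by `d + 1`, must exceed `2 * N`.
  obtain ⟨d, hd⟩ := exists_nat_gt
    (2 * N / (∑ i ∈ Finset.range N, y i - ∑ i ∈ Finset.range N, x i))
  rw [div_lt_iff₀ (sub_pos.2 h)] at hd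
  have hd0 : (0 : ℝ) < d + 1 := by positivity
  -- Ceiling minus one gives a strict lower bound even at integers; truncated subtraction yields `0`
  -- when `y i` is not positive.
  have hn : ∀ i, ⌈y i * (d + 1)⌉₊ - 1 = 0 ∨ ((⌈y i * (d + 1)⌉₊ - 1 : ℕ) : ℝ) < y i * (d + 1) := by
    intro i
    rcases Nat.eq_zero_or_pos (⌈y i * (d + 1)⌉₊ - 1) with h0 | h0
    · exact Or.inl h0
    · exact Or.inr (Nat.lt_ceil.1 (by omega))
  refine ⟨d, fun i => ⌊x i * (d + 1)⌋₊ + 1, fun i => ⌈y i * (d + 1)⌉₊ - 1, fun i => ?_,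
    fun i => (hn i).imp id fun h => ?_, ?_⟩
  · rw [lt_div_iff₀ hd0]
    push_cast
    exact Nat.lt_floor_add_one _
  · rwa [div_lt_iff₀ hd0]
  · have hm : ((∑ i ∈ Finset.range N, (⌊x i * (d + 1)⌋₊ + 1) : ℕ) : ℝ) ≤
        (∑ i ∈ Finset.range N, x i) * (d + 1) + N := by
      push_cast
      rw [Finset.sum_add_distrib, Finset.sum_mul]
      simp only [Finset.sum_const, Finset.card_range, nsmul_eq_mul, mul_one]
      gcongr with i hi
      exact Nat.floor_le (mul_nonneg (hx i) hd0.le)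
    have hn' : (∑ i ∈ Finset.range N, y i) * (d + 1) - N ≤
        ((∑ i ∈ Finset.range N, (⌈y i * (d + 1)⌉₊ - 1) : ℕ) : ℝ) := by
      push_cast
      rw [Finset.sum_mul, sub_le_iff_le_add]
      have : (N : ℝ) = ∑ i ∈ Finset.range N, (1 : ℝ) := by simp
      rw [this, ← Finset.sum_add_distrib]
      refine Finset.sum_le_sum fun i _ => (Nat.le_ceil _).trans ?_
      exact_mod_cast (by omega : ⌈y i * (d + 1)⌉₊ ≤ ⌈y i * (d + 1)⌉₊ - 1 + 1)
    have : ((∑ i ∈ Finset.range N, (⌊x i * (d + 1)⌋₊ + 1) : ℕ) : ℝ) ≤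
        ((∑ i ∈ Finset.range N, (⌈y i * (d + 1)⌉₊ - 1) : ℕ) : ℝ) := by
      refine hm.trans (le_trans ?_ hn')
      nlinarith
    exact_mod_cast this

/-- If a sum of powers is smaller than another one, then there is a witness, valid for all
exponents close enough to `p`. -/
theorem exists_sumPowLt {xs ys : List QCode} {N : ℕ} {p : ℝ} (hp : 0 < p)
    {a b : ℕ → ℝ} (hx : xs.length = N) (hy : ys.length = N)
    (ha : ∀ i, 0 ≤ a i) (hb : ∀ i, 0 ≤ b i)
    (hxa : ∀ i < N, (ratOfCode (xs.getD i (0, 0, 0)) : ℝ) = a i ^ 2)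
    (hyb : ∀ i < N, (ratOfCode (ys.getD i (0, 0, 0)) : ℝ) = b i ^ 2)
    (h : ∑ i ∈ Finset.range N, a i ^ p < ∑ i ∈ Finset.range N, b i ^ p) :
    ∃ w : SumWitness, ∃ ε > 0, ∀ e : ExpPair,
      |((e.1.1 / (e.1.2 + 1) : ℚ) : ℝ) - p| < ε → |((e.2.1 / (e.2.2 + 1) : ℚ) : ℝ) - p| < ε →
      SumPowLt e w xs ys := by
  obtain ⟨d, m, n, hm, hn, hS⟩ := exists_nat_approx (fun i => Real.rpow_nonneg (ha i) p) h
  -- Since `p ≠ 0`, the base may be `0`. Continuity in the exponent lets finitely many strict bounds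
  -- at `p` persist nearby.
  have hcont : ∀ c : ℝ, ContinuousAt (fun r : ℝ => c ^ r) p := fun c =>
    Real.continuousAt_const_rpow' hp.ne'
  have h1 : ∀ᶠ r in nhds p, ∀ i ∈ Finset.range N, a i ^ r < (m i : ℝ) / (d + 1) :=
    (Filter.eventually_all_finset _).2 fun i _ =>
      (hcont (a i)).eventually_lt continuousAt_const (hm i)
  have h2 : ∀ᶠ r in nhds p, ∀ i ∈ Finset.range N, n i = 0 ∨ (n i : ℝ) / (d + 1) < b i ^ r := by
    refine (Filter.eventually_all_finset _).2 fun i _ => ?_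
    rcases hn i with h | h
    · exact Filter.Eventually.of_forall fun _ => Or.inl h
    · exact (continuousAt_const.eventually_lt (hcont (b i)) h).mono fun _ => Or.inr
  obtain ⟨ε, hε, H⟩ := Metric.eventually_nhds_iff.1 (h1.and h2)
  have hgetD : ∀ (f : ℕ → ℕ) (i), i < N → ((List.range N).map f).getD i 0 = f i := by
    intro f i hi
    simp [List.getD, hi]
  refine ⟨(d, (List.range N).map m, (List.range N).map n), ε, hε, fun e he1 he2 => ⟨?_, ?_, ?_⟩⟩
  · intro i hi
    rw [hx] at hi
    have hi' := Finset.mem_range.2 hi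
    dsimp only
    rw [hgetD m i hi]
    exact (powLt_iff (ha i) (hxa i hi) _ _).2 ⟨(H he1).1 i hi', (H he2).1 i hi'⟩
  · intro i hi
    rw [hy] at hi
    have hi' := Finset.mem_range.2 hi
    dsimp only
    rw [hgetD n i hi]
    rcases (H he1).2 i hi' with h3 | h3
    · exact Or.inl h3
    rcases (H he2).2 i hi' with h4 | h4
    · exact Or.inl h4
    exact Or.inr ((ltPow_iff (hb i) (hyb i hi) _ _).2 ⟨h3, h4⟩)
  · rw [foldr_add_map_range, foldr_add_map_range, hx, hy]
    refine le_of_eq_of_le (Finset.sum_congr rfl fun i hi => ?_)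
      (hS.trans_eq (Finset.sum_congr rfl fun i hi => ?_))
    · exact hgetD m i (Finset.mem_range.1 hi)
    · exact (hgetD n i (Finset.mem_range.1 hi)).symm

theorem exists_brackets {q : ℕ → QCode} {p ε : ℝ} (hp : 0 < p) (hε : 0 < ε)
    (hq : ∀ k, |p - (ratOfCode (q k) : ℝ)| < (1 / 2 : ℝ) ^ k) :
    ∃ (e : ExpPair) (k : ℕ), Brackets e k (q k) ∧
      |((e.1.1 / (e.1.2 + 1) : ℚ) : ℝ) - p| < ε ∧ |((e.2.1 / (e.2.2 + 1) : ℚ) : ℝ) - p| < ε := by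
  have hrep : ∀ r : ℚ, 0 < r → ∃ u v : ℕ, 0 < u ∧ (u / (v + 1) : ℚ) = r := by
    intro r hr
    refine ⟨r.num.toNat, r.den - 1, by simpa using hr, ?_⟩
    have h1 : ((r.num.toNat : ℕ) : ℚ) = r.num := by
      exact_mod_cast Int.toNat_of_nonneg (Rat.num_nonneg.2 hr.le)
    have h2 : ((r.den - 1 : ℕ) : ℚ) + 1 = r.den := by
      exact_mod_cast Nat.sub_add_cancel r.pos
    rw [h1, h2, Rat.num_div_den]
  obtain ⟨r, hr1, hr2⟩ := exists_rat_btwn (max_lt hp (sub_lt_self p hε))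
  obtain ⟨s, hs1, hs2⟩ := exists_rat_btwn (lt_add_of_pos_right p hε)
  have hr0 : 0 < r := by exact_mod_cast (le_max_left _ _).trans_lt hr1
  have hs0 : 0 < s := by exact_mod_cast hp.trans hs1
  obtain ⟨u, v, hu, huv⟩ := hrep r hr0
  obtain ⟨u', v', -, huv'⟩ := hrep s hs0
  -- The bound is halved because an error `2⁻ᵏ` occurs twice: once in `q k` and once in the safety
  -- margin of `Brackets`.
  obtain ⟨k, hk⟩ := exists_pow_lt_of_lt_one
    (show 0 < min (p - r) (s - p) / 2 by
      have := lt_min (sub_pos.2 hr2) (sub_pos.2 hs1); positivity) (one_half_lt_one (α := ℝ))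
  have hk1 := min_le_left (p - r) (s - p)
  have hk2 := min_le_right (p - r) (s - p)
  have hc : ratOfCode (1, 0, 2 ^ k - 1) = (1 / 2) ^ k := by
    rw [ratOfCode_frac, Nat.cast_sub Nat.one_le_two_pow]
    simp
  have hqk := abs_lt.1 (hq k)
  refine ⟨((u, v), (u', v')), k, ⟨hu, ?_, ?_⟩, ?_, ?_⟩
  · rw [QCode.lt_iff, ratOfCode_add, hc, ratOfCode_frac, huv, ← Rat.cast_lt (K := ℝ)]
    push_cast
    linarith
  · rw [QCode.lt_iff, ratOfCode_add, hc, ratOfCode_frac, huv', ← Rat.cast_lt (K := ℝ)]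
    push_cast
    linarith
  · dsimp only
    rw [huv, abs_lt]
    have := (le_max_right 0 (p - ε)).trans_lt hr1
    constructor <;> linarith
  · dsimp only
    rw [huv', abs_lt]
    constructor <;> linarith

/-! ### Positions of the elements of an order -/

section Positions

theorem le_lowerNeighbor {s : List Bool} {n j : ℕ} {x : List ℕ} (hj : j < n)
    (h : s.getD (Nat.pair j n) false = true) : x.getD j 0 ≤ lowerNeighbor s n x := by
  have key : ∀ l : List ℕ, j ∈ l → x.getD j 0 ≤ l.foldr
      (fun j z => if s.getD (Nat.pair j n) false = true then max (x.getD j 0) z else z) 0 := by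
    intro l hl
    induction l with
    | nil => simp at hl
    | cons i l ih =>
      rw [List.foldr_cons]
      rcases List.mem_cons.1 hl with rfl | hl
      · rw [if_pos h]
        exact le_max_left _ _
      · split_ifs
        · exact (ih hl).trans (le_max_right _ _)
        · exact ih hl
  exact key _ (List.mem_range.2 hj)

theorem lowerNeighbor_eq (s : List Bool) (n : ℕ) (x : List ℕ) :
    lowerNeighbor s n x = 0 ∨ ∃ j < n, s.getD (Nat.pair j n) false = true ∧
      lowerNeighbor s n x = x.getD j 0 := by
  have key : ∀ l : List ℕ, (∀ i ∈ l, i < n) → l.foldr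
      (fun j z => if s.getD (Nat.pair j n) false = true then max (x.getD j 0) z else z) 0 = 0 ∨
      ∃ j < n, s.getD (Nat.pair j n) false = true ∧ l.foldr
      (fun j z => if s.getD (Nat.pair j n) false = true then max (x.getD j 0) z else z) 0 =
        x.getD j 0 := by
    intro l hl
    induction l with
    | nil => simp
    | cons i l ih =>
      rw [List.foldr_cons]
      have ih' := ih fun i hi => hl i (List.mem_cons_of_mem _ hi)
      split_ifs with h
      · rcases max_choice (x.getD i 0) (l.foldr
          (fun j z => if s.getD (Nat.pair j n) false = true then max (x.getD j 0) z else z) 0)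
          with h' | h' <;> rw [h']
        · exact Or.inr ⟨i, hl i List.mem_cons_self, h, rfl⟩
        · exact ih'
      · exact ih'
  exact key _ fun i hi => List.mem_range.1 hi

theorem upperNeighbor_le {s : List Bool} {n j : ℕ} {x : List ℕ} (hj : j < n)
    (h : s.getD (Nat.pair n j) false = true) : upperNeighbor s n x ≤ x.getD j 0 := by
  have key : ∀ l : List ℕ, j ∈ l → l.foldr
      (fun j z => if s.getD (Nat.pair n j) false = true then min (x.getD j 0) z else z) (2 ^ n) ≤
        x.getD j 0 := by
    intro l hl
    induction l with
    | nil => simp at hl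
    | cons i l ih =>
      rw [List.foldr_cons]
      rcases List.mem_cons.1 hl with rfl | hl
      · rw [if_pos h]
        exact min_le_left _ _
      · split_ifs
        · exact (min_le_right _ _).trans (ih hl)
        · exact ih hl
  exact key _ (List.mem_range.2 hj)

theorem upperNeighbor_eq (s : List Bool) (n : ℕ) (x : List ℕ) :
    upperNeighbor s n x = 2 ^ n ∨ ∃ j < n, s.getD (Nat.pair n j) false = true ∧
      upperNeighbor s n x = x.getD j 0 := by
  have key : ∀ l : List ℕ, (∀ i ∈ l, i < n) → l.foldr
      (fun j z => if s.getD (Nat.pair n j) false = true then min (x.getD j 0) z else z) (2 ^ n) =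
        2 ^ n ∨
      ∃ j < n, s.getD (Nat.pair n j) false = true ∧ l.foldr
      (fun j z => if s.getD (Nat.pair n j) false = true then min (x.getD j 0) z else z) (2 ^ n) =
        x.getD j 0 := by
    intro l hl
    induction l with
    | nil => simp
    | cons i l ih =>
      rw [List.foldr_cons]
      have ih' := ih fun i hi => hl i (List.mem_cons_of_mem _ hi)
      split_ifs with h
      · rcases min_choice (x.getD i 0) (l.foldr
          (fun j z => if s.getD (Nat.pair n j) false = true then min (x.getD j 0) z else z) (2 ^ n))
          with h' | h' <;> rw [h']
        · exact Or.inr ⟨i, hl i List.mem_cons_self, h, rfl⟩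
        · exact ih'
      · exact ih'
  exact key _ fun i hi => List.mem_range.1 hi

theorem positions_succ (s : List Bool) (n : ℕ) : positions s (n + 1) =
    (positions s n).map (2 * ·) ++
      [lowerNeighbor s n (positions s n) + upperNeighbor s n (positions s n)] := rfl

theorem length_positions (s : List Bool) (n : ℕ) : (positions s n).length = n := by
  induction n with
  | zero => rfl
  | succ n ih => simp [positions_succ, ih]

/-- This is why `n * n` bits of the diagram determine the order among the numbers below `n`. -/
theorem pair_lt_mul_self {i j n : ℕ} (hi : i < n) (hj : j < n) : Nat.pair i j < n * n := by
  have h := Nat.pair_lt_max_add_one_sq i j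
  have h' : max i j + 1 ≤ n := Nat.succ_le_of_lt (max_lt hi hj)
  exact h.trans_le ((Nat.pow_le_pow_left h' 2).trans_eq (sq n))

theorem positions_congr {s t : List Bool} {n : ℕ}
    (h : ∀ i < n * n, s.getD i false = t.getD i false) : positions s n = positions t n := by
  induction n with
  | zero => rfl
  | succ n ih =>
    have ih' := ih fun i hi => h i (by nlinarith)
    have h1 : lowerNeighbor s n (positions t n) = lowerNeighbor t n (positions t n) := by
      refine List.foldr_ext _ _ _ fun j hj z => ?_
      have hj' : j < n := List.mem_range.1 hj
      rw [h _ (pair_lt_mul_self (by omega) (by omega))]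
    have h2 : upperNeighbor s n (positions t n) = upperNeighbor t n (positions t n) := by
      refine List.foldr_ext _ _ _ fun j hj z => ?_
      have hj' : j < n := List.mem_range.1 hj
      rw [h _ (pair_lt_mul_self (by omega) (by omega))]
    rw [positions_succ, positions_succ, ih', h1, h2]

theorem getD_initialSegment (f : ℕ → Bool) {k i : ℕ} (h : i < k) :
    (initialSegment f k).getD i false = f i := by
  simp [initialSegment, List.getD, h]

/-- The position of the number `n` in the unit interval. -/
noncomputable def position (f : ℕ → Bool) (n : ℕ) : ℝ :=
  ((positions (initialSegment f ((n + 1) * (n + 1))) (n + 1)).getD n 0 : ℕ) / 2 ^ (n + 1)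

theorem getD_positions_succ (s : List Bool) {n j : ℕ} (hj : j < n) :
    (positions s (n + 1)).getD j 0 = 2 * (positions s n).getD j 0 := by
  rw [positions_succ, List.getD_append _ _ _ _ (by simpa [length_positions] using hj)]
  simp [List.getD, length_positions, hj]

theorem getD_positions_self (s : List Bool) (n : ℕ) :
    (positions s (n + 1)).getD n 0 =
      lowerNeighbor s n (positions s n) + upperNeighbor s n (positions s n) := by
  rw [positions_succ, List.getD_append_right _ _ _ _ (by simp [length_positions])]
  simp [length_positions]

/-- Each stage doubles the old numerators along with the denominator, so a position never changes
once it has been assigned. -/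
theorem getD_positions (f : ℕ → Bool) (s : List Bool) {n j : ℕ} (hj : j < n)
    (hs : ∀ i < n * n, s.getD i false = f i) :
    ((positions s n).getD j 0 : ℝ) = position f j * 2 ^ n := by
  induction n with
  | zero => omega
  | succ n ih =>
    rcases (Nat.lt_succ_iff.1 hj).eq_or_lt with rfl | hj'
    · rw [position, div_mul_cancel₀ _ (by positivity)]
      rw [positions_congr (s := s) fun i hi => ?_]
      rw [hs i hi, getD_initialSegment f hi]
    · rw [getD_positions_succ s hj', pow_succ, ← mul_assoc,
        ← ih hj' fun i hi => hs i (by nlinarith)]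
      push_cast
      ring

theorem position_spec (f : ℕ → Bool) (n : ℕ) : ∃ l r : ℝ, position f n = (l + r) / 2 ∧
    (∀ j < n, f (Nat.pair j n) = true → position f j ≤ l) ∧
    (l = 0 ∨ ∃ j < n, f (Nat.pair j n) = true ∧ l = position f j) ∧
    (∀ j < n, f (Nat.pair n j) = true → r ≤ position f j) ∧
    (r = 1 ∨ ∃ j < n, f (Nat.pair n j) = true ∧ r = position f j) := by
  set s := initialSegment f ((n + 1) * (n + 1)) with hs
  have hsf : ∀ i < (n + 1) * (n + 1), s.getD i false = f i := fun i hi => getD_initialSegment f hi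
  have hpos : ∀ j < n, ((positions s n).getD j 0 : ℝ) = position f j * 2 ^ n := fun j hj =>
    getD_positions f s hj fun i hi => hsf i (by nlinarith)
  have h2 : (0 : ℝ) < 2 ^ n := by positivity
  refine ⟨lowerNeighbor s n (positions s n) / 2 ^ n, upperNeighbor s n (positions s n) / 2 ^ n,
    ?_, fun j hj hf => ?_, ?_, fun j hj hf => ?_, ?_⟩
  · rw [position, ← hs, getD_positions_self, pow_succ]
    push_cast
    field_simp
  · rw [le_div_iff₀ h2, ← hpos j hj]
    rw [← hsf _ (pair_lt_mul_self (by omega) (by omega))] at hf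
    exact_mod_cast le_lowerNeighbor hj hf
  · rcases lowerNeighbor_eq s n (positions s n) with h | ⟨j, hj, hf, h⟩
    · left
      simp [h]
    · right
      refine ⟨j, hj, ?_, ?_⟩
      · rwa [← hsf _ (pair_lt_mul_self (by omega) (by omega))]
      · rw [h, hpos j hj, mul_div_cancel_right₀ _ h2.ne']
  · rw [div_le_iff₀ h2, ← hpos j hj]
    rw [← hsf _ (pair_lt_mul_self (by omega) (by omega))] at hf
    exact_mod_cast upperNeighbor_le hj hf
  · rcases upperNeighbor_eq s n (positions s n) with h | ⟨j, hj, hf, h⟩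
    · left
      simp [h]
    · right
      refine ⟨j, hj, ?_, ?_⟩
      · rwa [← hsf _ (pair_lt_mul_self (by omega) (by omega))]
      · rw [h, hpos j hj, mul_div_cancel_right₀ _ h2.ne']

end Positions

/-! ### Positions under a diagram of an order: monotonicity and gaps. -/

section Order

variable {L : Type*} [LinearOrder L] {e : L ↪ ℕ} {f : ℕ → Bool}

/-- `f` is the diagram of `L` when each element is represented by its image under `e`. -/
def IsDiagramBy {L : Type*} [LinearOrder L] (e : L ↪ ℕ) (f : ℕ → Bool) : Prop :=
  ∀ m n, f (Nat.pair m n) = true ↔ ∃ a b : L, e a = m ∧ e b = n ∧ a ≤ b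

theorem diagram_pair_iff (hf : IsDiagramBy e f) (a b : L) :
    f (Nat.pair (e a) (e b)) = true ↔ a ≤ b := by
  rw [hf _ _]
  constructor
  · rintro ⟨a', b', ha, hb, h⟩
    rwa [← e.injective ha, ← e.injective hb]
  · exact fun h => ⟨a, b, rfl, rfl, h⟩

/-- Numbers that represent no element also receive positions, but the diagram relates them to
nothing, so they are never neighbours. -/
theorem position_spec_order (hf : IsDiagramBy e f) (c : L) :
    ∃ l r : ℝ, position f (e c) = (l + r) / 2 ∧
    (∀ a, e a < e c → a < c → position f (e a) ≤ l) ∧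
    (l = 0 ∨ ∃ a, e a < e c ∧ a < c ∧ l = position f (e a)) ∧
    (∀ a, e a < e c → c < a → r ≤ position f (e a)) ∧
    (r = 1 ∨ ∃ a, e a < e c ∧ c < a ∧ r = position f (e a)) := by
  obtain ⟨l, r, h0, h1, h2, h3, h4⟩ := position_spec f (e c)
  refine ⟨l, r, h0, fun a ha hac => h1 _ ha ((diagram_pair_iff hf a c).2 hac.le), h2.imp id ?_,
    fun a ha hac => h3 _ ha ((diagram_pair_iff hf c a).2 hac.le), h4.imp id ?_⟩
  · rintro ⟨j, hj, hfj, hl⟩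
    obtain ⟨a, b, rfl, hb, hab⟩ := (hf _ _).1 hfj
    obtain rfl := e.injective hb
    exact ⟨a, hj, hab.lt_of_ne (by rintro rfl; exact hj.ne rfl), hl⟩
  · rintro ⟨j, hj, hfj, hl⟩
    obtain ⟨a, b, ha, rfl, hab⟩ := (hf _ _).1 hfj
    obtain rfl := e.injective ha
    exact ⟨b, hj, hab.lt_of_ne (by rintro rfl; exact hj.ne rfl), hl⟩

/-- Induction on codes: the neighbours of the new element are already in the right order, so their
midpoint lies strictly between them. -/
theorem position_mono_aux (hf : IsDiagramBy e f) (n : ℕ) :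
    (∀ a, e a < n → 0 < position f (e a) ∧ position f (e a) < 1) ∧
    ∀ a b, e a < n → e b < n → a < b → position f (e a) < position f (e b) := by
  induction n with
  | zero => simp
  | succ n ih =>
    obtain ⟨ih1, ih2⟩ := ih
    have key : ∀ c, e c = n → (0 < position f (e c) ∧ position f (e c) < 1) ∧
        (∀ a, e a < n → a < c → position f (e a) < position f (e c)) ∧
        (∀ a, e a < n → c < a → position f (e c) < position f (e a)) := by
      rintro c rfl
      obtain ⟨l, r, h0, h1, h2, h3, h4⟩ := position_spec_order hf c
      have hl : 0 ≤ l ∧ l < 1 := by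
        rcases h2 with rfl | ⟨a, ha, -, rfl⟩
        · simp
        · exact ⟨(ih1 a ha).1.le, (ih1 a ha).2⟩
      have hr : 0 < r ∧ r ≤ 1 := by
        rcases h4 with rfl | ⟨a, ha, -, rfl⟩
        · simp
        · exact ⟨(ih1 a ha).1, (ih1 a ha).2.le⟩
      have hlr : l < r := by
        rcases h2 with rfl | ⟨a, ha, hac, rfl⟩
        · exact hr.1
        · rcases h4 with rfl | ⟨b, hb, hcb, rfl⟩
          · exact hl.2
          · exact ih2 a b ha hb (hac.trans hcb)
      refine ⟨⟨by linarith, by linarith⟩, fun a ha hac => ?_, fun a ha hac => ?_⟩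
      · have := h1 a ha hac
        linarith
      · have := h3 a ha hac
        linarith
    refine ⟨fun a ha => ?_, fun a b ha hb hab => ?_⟩
    · rcases (Nat.lt_succ_iff.1 ha).eq_or_lt with h | h
      · exact (key a h).1
      · exact ih1 a h
    · rcases (Nat.lt_succ_iff.1 ha).eq_or_lt with h | h <;>
        rcases (Nat.lt_succ_iff.1 hb).eq_or_lt with h' | h'
      · exact absurd (e.injective (h.trans h'.symm)) hab.ne
      · exact (key a h).2.2 b h' hab
      · exact (key b h').2.1 a h hab
      · exact ih2 a b h h' hab

theorem position_mem_Ioo (hf : IsDiagramBy e f) (a : L) :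
    position f (e a) ∈ Set.Ioo 0 1 :=
  (position_mono_aux hf (e a + 1)).1 a (Nat.lt_succ_self _)

theorem strictMono_position (hf : IsDiagramBy e f) :
    StrictMono fun a => position f (e a) := fun a b hab =>
  (position_mono_aux hf (max (e a) (e b) + 1)).2 a b (by omega) (by omega) hab

theorem position_eq_midpoint (hf : IsDiagramBy e f) {a b c : L}
    (ha : e a < e c) (hb : e b < e c) (hac : a < c) (hcb : c < b)
    (h : ∀ d, e d < e c → d ≤ a ∨ b ≤ d) :
    position f (e c) = (position f (e a) + position f (e b)) / 2 := by
  have hm := (strictMono_position hf).monotone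
  obtain ⟨l, r, h0, h1, h2, h3, h4⟩ := position_spec_order hf c
  have hl : l = position f (e a) := by
    refine le_antisymm ?_ (h1 a ha hac)
    rcases h2 with rfl | ⟨d, hd, hdc, rfl⟩
    · exact (position_mem_Ioo hf a).1.le
    · rcases h d hd with h | h
      · exact hm h
      · exact absurd (hdc.trans hcb) h.not_gt
  have hr : r = position f (e b) := by
    refine le_antisymm (h3 b hb hcb) ?_
    rcases h4 with rfl | ⟨d, hd, hdc, rfl⟩
    · exact (position_mem_Ioo hf b).2.le
    · rcases h d hd with h | h
      · exact absurd (hac.trans hdc) h.not_gt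
      · exact hm h
  rw [h0, hl, hr]

/-- A cut of the order whose sides stay apart in the real line is an adjacency. -/
def GapsAreAdjacencies {L : Type*} [LinearOrder L] (h : L → ℝ) : Prop :=
  ∀ (A : Set L) (ε : ℝ), 0 < ε → IsLowerSet A → A.Nonempty → Aᶜ.Nonempty →
    (∀ a ∈ A, ∀ b ∉ A, ε ≤ h b - h a) → ∃ a ∈ A, ∃ b ∉ A, a ⋖ b

/-- Let `g > 0` be the infimum of the distances across the cut. Two points on opposite sides at
distance less than `2 * g`, nearest to the cut up to some stage, must be adjacent: the first element
inserted between them would be their midpoint, at distance less than `g` from the one on the other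
side. -/
theorem gapsAreAdjacencies_position (hf : IsDiagramBy e f) :
    GapsAreAdjacencies fun a => position f (e a) := by
  intro A ε hε hA ⟨a₀, ha₀⟩ ⟨b₀, hb₀⟩ hgap
  set h : L → ℝ := fun a => position f (e a) with hh
  have hm : StrictMono h := strictMono_position hf
  set S : Set ℝ := {x | ∃ a ∈ A, ∃ b ∉ A, x = h b - h a} with hS
  have hSne : S.Nonempty := ⟨_, a₀, ha₀, b₀, hb₀, rfl⟩
  have hSbdd : BddBelow S := ⟨ε, by rintro x ⟨a, ha, b, hb, rfl⟩; exact hgap a ha b hb⟩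
  have hg : 0 < sInf S :=
    hε.trans_le (le_csInf hSne (by rintro x ⟨a, ha, b, hb, rfl⟩; exact hgap a ha b hb))
  obtain ⟨x, ⟨a, ha, b, hb, rfl⟩, hab⟩ := exists_lt_of_csInf_lt hSne
    (show sInf S < 2 * sInf S by linarith)
  -- Only finitely many elements have codes up to this bound; `a'` and `b'` will be the ones among
  -- them nearest to the cut, on its two sides.
  have hfin : {x : L | e x ≤ max (e a) (e b)}.Finite :=
    (Set.finite_Iic (max (e a) (e b))).preimage e.injective.injOn
  obtain ⟨a', ⟨ha'A, ha'n⟩, ha'max⟩ := Set.exists_max_image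
    (A ∩ {x : L | e x ≤ max (e a) (e b)}) id (hfin.inter_of_right _) ⟨a, ha, le_max_left (e a) (e b)⟩
  obtain ⟨b', ⟨hb'A, hb'n⟩, hb'min⟩ := Set.exists_min_image
    (Aᶜ ∩ {x : L | e x ≤ max (e a) (e b)}) id (hfin.inter_of_right _) ⟨b, hb, le_max_right (e a) (e b)⟩
  have hlt : a' < b' := lt_of_not_ge fun hle => hb'A (hA hle ha'A)
  have h1 : h b' - h a' < 2 * sInf S := by
    have h2 := hm.monotone (ha'max a ⟨ha, le_max_left (e a) (e b)⟩)
    have h3 := hm.monotone (hb'min b ⟨hb, le_max_right (e a) (e b)⟩)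
    simp only [id] at h2 h3
    linarith
  refine ⟨a', ha'A, b', hb'A, hlt, fun c₀ hc₀ hc₀' => ?_⟩
  -- Least code strictly between `a'` and `b'`: at its insertion these two are its neighbours.
  obtain ⟨c, ⟨hac, hcb⟩, hmin⟩ := exists_minimalFor_of_wellFoundedLT
    (fun c => a' < c ∧ c < b') e ⟨c₀, hc₀, hc₀'⟩
  have hcn : max (e a) (e b) < e c := by
    by_contra! hcn
    by_cases hcA : c ∈ A
    · exact (ha'max c ⟨hcA, hcn⟩).not_gt hac
    · exact (hb'min c ⟨hcA, hcn⟩).not_gt hcb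
  have hmid : h c = (h a' + h b') / 2 := by
    refine position_eq_midpoint hf (lt_of_le_of_lt ha'n hcn) (lt_of_le_of_lt hb'n hcn) hac hcb ?_
    intro d hd
    by_contra! hd'
    exact (hmin hd' hd.le).not_gt hd
  by_cases hcA : c ∈ A
  · have := csInf_le hSbdd ⟨c, hcA, b', hb'A, rfl⟩
    linarith
  · have := csInf_le hSbdd ⟨a', ha'A, c, hcA, rfl⟩
    linarith

end Order

/-! ### The measure space of an order -/

/-- The real line, with the σ-algebra generated by the intervals `[h a, h b)`. -/
def OrderLine {L : Type*} (_h : L → ℝ) : Type := ℝ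

namespace OrderLine

variable {L : Type*} (h : L → ℝ)

/-- Reals as points of the line. -/
def mk (x : ℝ) : OrderLine h := x

/-- Points of the line as reals. -/
def val {h : L → ℝ} (x : OrderLine h) : ℝ := x

/-- The interval `[h a, h b)`. -/
def cell (a b : L) : Set (OrderLine h) := {x | x.val ∈ Set.Ico (h a) (h b)}

theorem cell_self (a : L) : cell h a a = ∅ := by
  ext x
  simp [cell]

/-- The union of the intervals `[h a, h b)`. -/
def hull : Set ℝ := ⋃ ab : L × L, Set.Ico (h ab.1) (h ab.2)

instance : MeasurableSpace (OrderLine h) :=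
  MeasurableSpace.generateFrom (Set.range fun ab : L × L => cell h ab.1 ab.2)

theorem measurableSet_cell (a b : L) : MeasurableSet (cell h a b) :=
  MeasurableSpace.measurableSet_generateFrom ⟨(a, b), rfl⟩

theorem measurable_mk : Measurable (mk h) := by
  refine measurable_generateFrom ?_
  rintro _ ⟨ab, rfl⟩
  exact measurableSet_Ico

/-- Lebesgue measure on the hull. -/
noncomputable def measure : Measure (OrderLine h) := (volume.restrict (hull h)).map (mk h)

theorem measure_apply {B : Set (OrderLine h)} (hB : MeasurableSet B) :
    measure h B = volume (mk h ⁻¹' B ∩ hull h) := by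
  rw [measure, Measure.map_apply (measurable_mk h) hB,
    Measure.restrict_apply (measurable_mk h hB)]

theorem Ico_subset_hull (a b : L) : Set.Ico (h a) (h b) ⊆ hull h :=
  Set.subset_iUnion (fun ab : L × L => Set.Ico (h ab.1) (h ab.2)) (a, b)

theorem measure_cell (a b : L) : measure h (cell h a b) = ENNReal.ofReal (h b - h a) := by
  rw [measure_apply h (measurableSet_cell h a b), ← Real.volume_Ico]
  congr 1
  exact Set.inter_eq_left.2 (Ico_subset_hull h a b)

theorem hull_subset_Ico (h01 : ∀ a, h a ∈ Set.Ioo 0 1) : hull h ⊆ Set.Ico 0 1 :=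
  Set.iUnion_subset fun ab _ hx => ⟨(h01 ab.1).1.le.trans hx.1, hx.2.trans (h01 ab.2).2⟩

theorem isFiniteMeasure (h01 : ∀ a, h a ∈ Set.Ioo 0 1) : IsFiniteMeasure (measure h) := by
  refine ⟨?_⟩
  rw [measure_apply h MeasurableSet.univ]
  refine (measure_mono (Set.inter_subset_right.trans (hull_subset_Ico h h01))).trans_lt ?_
  simp

theorem measurableSet_hull [Countable L] : MeasurableSet (hull h) :=
  MeasurableSet.iUnion fun _ => measurableSet_Ico

/-! ### Atoms -/

variable {h}

theorem exists_cell_inter_ne_zero [Countable L] {A : Set (OrderLine h)} (hA : MeasurableSet A)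
    (hA0 : measure h A ≠ 0) : ∃ a b, measure h (A ∩ cell h a b) ≠ 0 := by
  by_contra! hall
  apply hA0
  have h1 : ∀ ab : L × L, volume (mk h ⁻¹' A ∩ Set.Ico (h ab.1) (h ab.2)) = 0 := by
    rintro ⟨a, b⟩
    have h2 := hall a b
    rw [measure_apply h (hA.inter (measurableSet_cell h a b))] at h2
    refine measure_mono_null ?_ h2
    exact fun x hx => ⟨⟨hx.1, hx.2⟩, Ico_subset_hull h a b hx.2⟩
  rw [measure_apply h hA, hull, Set.inter_iUnion]
  exact measure_iUnion_null h1

variable [LinearOrder L]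

/-- No value of `h` lies strictly inside the cell of an adjacency, so no generator splits it. Not
splitting a given set survives complements and countable unions. -/
theorem cell_subset_or_disjoint (hm : StrictMono h) {a b : L} (hab : a ⋖ b)
    {B : Set (OrderLine h)} (hB : MeasurableSet B) : cell h a b ⊆ B ∨ Disjoint (cell h a b) B := by
  induction B, hB using MeasurableSpace.generateFrom_induction with
  | hC t ht _ =>
    obtain ⟨⟨c, d⟩, rfl⟩ := ht
    rcases lt_or_ge a c with hac | hca
    · refine Or.inr (Set.disjoint_left.2 fun x hx hx' => ?_)
      exact (hx.2.trans_le (hm.monotone (hab.ge_of_gt hac))).not_ge hx'.1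
    rcases lt_or_ge d b with hdb | hbd
    · refine Or.inr (Set.disjoint_left.2 fun x hx hx' => ?_)
      exact (hx'.2.trans_le (hm.monotone (hab.le_of_lt hdb))).not_ge hx.1
    · exact Or.inl fun x hx => ⟨(hm.monotone hca).trans hx.1, hx.2.trans_le (hm.monotone hbd)⟩
  | empty => exact Or.inr (Set.disjoint_empty _)
  | compl t _ ih =>
    rcases ih with ih | ih
    · exact Or.inr (Set.disjoint_compl_right_iff_subset.2 ih)
    · exact Or.inl (Set.subset_compl_iff_disjoint_right.2 ih)
  | iUnion t _ ih =>
    by_cases hex : ∃ n, cell h a b ⊆ t n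
    · obtain ⟨n, hn⟩ := hex
      exact Or.inl (hn.trans (Set.subset_iUnion t n))
    · push Not at hex
      exact Or.inr (Set.disjoint_iUnion_right.2 fun n => (ih n).resolve_left (hex n))

theorem isMeasureAtom_cell (hm : StrictMono h) {a b : L} (hab : a ⋖ b) :
    IsMeasureAtom (measure h) (cell h a b) := by
  refine ⟨measurableSet_cell h a b, ?_, fun B hB hBsub => ?_⟩
  · rw [measure_cell]
    simpa using hm hab.lt
  · rcases cell_subset_or_disjoint hm hab hB with h' | h'
    · right
      rw [Set.sdiff_eq_empty.2 h', measure_empty]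
    · left
      rw [Set.disjoint_of_subset_left hBsub h' |>.eq_bot_of_self, Set.bot_eq_empty, measure_empty]

/-- As `c` increases, the measure of `A ∩ [h a₀, h c)` jumps from zero to that of all of `A`. Almost
all of `A` then lies in every cell that crosses the jump, so the gap there is at least the measure
of `A` and comes from an adjacency. The cell of this adjacency is itself an atom, hence equals `A`
up to null sets. -/
theorem exists_ae_eq_cell [Countable L] (hm : StrictMono h) (hgap : GapsAreAdjacencies h)
    [IsFiniteMeasure (measure h)] {A : Set (OrderLine h)} (hA : IsMeasureAtom (measure h) A) :
    ∃ a b, a ⋖ b ∧ cell h a b =ᵐ[measure h] A := by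
  obtain ⟨hAm, hA0, hAtom⟩ := hA
  obtain ⟨a₀, b₀, hab₀⟩ := exists_cell_inter_ne_zero hAm hA0
  have hcompl : ∀ c, measure h (A ∩ cell h a₀ c) ≠ 0 → measure h (A \ cell h a₀ c) = 0 := by
    intro c hc
    rw [← Set.sdiff_self_inter]
    exact (hAtom _ (hAm.inter (measurableSet_cell h a₀ c)) Set.inter_subset_left).resolve_left hc
  have hsub : ∀ a b, A ⊆ (A \ cell h a₀ b) ∪ (A ∩ cell h a₀ a) ∪ (A ∩ cell h a b) := by
    intro a b x hx
    by_cases h1 : x ∈ cell h a₀ b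
    · by_cases h2 : x ∈ cell h a₀ a
      · exact Or.inl (Or.inr ⟨hx, h2⟩)
      · refine Or.inr ⟨hx, ?_, h1.2⟩
        by_contra! h3
        exact h2 ⟨h1.1, h3⟩
    · exact Or.inl (Or.inl ⟨hx, h1⟩)
  obtain ⟨a, ha, b, hb, hab⟩ := hgap {c | measure h (A ∩ cell h a₀ c) = 0}
    (measure h A).toReal (ENNReal.toReal_pos hA0 (measure_ne_top _ _))
    (fun c d hdc hc => measure_mono_null (t := A ∩ cell h a₀ c) (fun x hx => ⟨hx.1, hx.2.1,
      hx.2.2.trans_le (hm.monotone hdc)⟩) hc)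
    ⟨a₀, by simp [cell_self]⟩ ⟨b₀, hab₀⟩ (by
      intro a ha b hb
      have h1 : measure h A ≤ ENNReal.ofReal (h b - h a) := by
        rw [← measure_cell]
        calc measure h A ≤ _ := measure_mono (hsub a b)
          _ ≤ measure h (A \ cell h a₀ b) + measure h (A ∩ cell h a₀ a) +
              measure h (A ∩ cell h a b) :=
            (measure_union_le _ _).trans (by gcongr; exact measure_union_le _ _)
          _ = measure h (A ∩ cell h a b) := by rw [hcompl b hb, ha, zero_add, zero_add]
          _ ≤ measure h (cell h a b) := measure_mono Set.inter_subset_right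
      have h2 : 0 < h b - h a := by
        rw [← ENNReal.ofReal_pos]
        exact (pos_iff_ne_zero.2 hA0).trans_le h1
      exact ENNReal.toReal_le_of_le_ofReal h2.le h1)
  have hdiff : measure h (A \ cell h a b) = 0 := by
    refine measure_mono_null (t := (A \ cell h a₀ b) ∪ (A ∩ cell h a₀ a)) ?_
      (measure_union_null (hcompl b hb) ha)
    exact fun x hx => (hsub a b hx.1).resolve_right fun h' => hx.2 h'.2
  refine ⟨a, b, hab, ae_eq_set.2 ⟨?_, hdiff⟩⟩
  rw [← Set.sdiff_inter_self_eq_sdiff]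
  refine ((isMeasureAtom_cell hm hab).2.2 _ (hAm.inter (measurableSet_cell h a b))
    Set.inter_subset_right).resolve_left fun h0 => hA0 ?_
  rw [← Set.inter_union_sdiff A (cell h a b)]
  exact measure_union_null h0 hdiff

/-- Different adjacencies have disjoint cells of positive measure. -/
theorem eq_of_cell_ae_eq (hm : StrictMono h) {a b c d : L} (hab : a ⋖ b) (hcd : c ⋖ d)
    (heq : cell h a b =ᵐ[measure h] cell h c d) : a = c ∧ b = d := by
  have hac : a = c := by
    by_contra hne
    have hdisj : cell h a b \ cell h c d = cell h a b := by
      refine sdiff_eq_left.2 (Set.disjoint_left.2 fun x hx hx' => ?_)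
      rcases lt_or_gt_of_ne hne with hlt | hlt
      · exact (hx.2.trans_le (hm.monotone (hab.ge_of_gt hlt))).not_ge hx'.1
      · exact (hx'.2.trans_le (hm.monotone (hcd.ge_of_gt hlt))).not_ge hx.1
    have h0 := (ae_eq_set.1 heq).1
    rw [hdisj] at h0
    exact (isMeasureAtom_cell hm hab).2.1 h0
  subst hac
  exact ⟨rfl, hab.unique_right hcd⟩

theorem numAtoms_measure [Countable L] (hm : StrictMono h) (hgap : GapsAreAdjacencies h)
    [IsFiniteMeasure (measure h)] : numAtoms (measure h) = numAdjacencies L := by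
  symm
  refine ENat.card_congr (Equiv.ofBijective (fun x : {x : L × L // x.1 ⋖ x.2} =>
    Quotient.mk (atomSetoid (measure h)) ⟨cell h x.1.1 x.1.2, isMeasureAtom_cell hm x.2⟩)
    ⟨fun x y hxy => ?_, fun A => ?_⟩)
  · obtain ⟨h1, h2⟩ := eq_of_cell_ae_eq hm x.2 y.2 (Quotient.exact hxy)
    exact Subtype.ext (Prod.ext h1 h2)
  · induction A using Quotient.inductionOn with
    | h A =>
      obtain ⟨a, b, hab, heq⟩ := exists_ae_eq_cell hm hgap A.2
      exact ⟨⟨(a, b), hab⟩, Quotient.sound heq⟩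

end OrderLine

/-! ### Isometric embeddings of `Lp` spaces -/

section Embedding

variable {𝕜 : Type*} [RCLike 𝕜] {X Y : Type*} [MeasurableSpace X] [MeasurableSpace Y]
  {μ : Measure X} {ν : Measure Y}

theorem nonempty_linearIsometry_of_map_restrict {p : ℝ≥0∞} [Fact (1 ≤ p)] (hp : p ≠ ∞)
    {s : Set X} (hs : MeasurableSet s) {φ : X → Y} (hφ : Measurable φ) {c : ℝ} (hc : 0 < c)
    (hmap : (μ.restrict s).map φ = ENNReal.ofReal c • ν) :
    Nonempty (Lp 𝕜 p ν →ₗᵢ[𝕜] Lp 𝕜 p μ) := by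
  -- The isometry is `g ↦ κ • g ∘ φ` on `s`, zero elsewhere; `κ` cancels the factor `c ^ (1 / p)`
  -- that the scaling of `ν` puts on the norm.
  set κ : 𝕜 := ((c ^ (-(1 / p.toReal)) : ℝ) : 𝕜) with hκ
  have hκn : ‖κ‖ₑ * ENNReal.ofReal c ^ (1 / p.toReal) = 1 := by
    rw [hκ, ← ofReal_norm, RCLike.norm_ofReal,
      abs_of_nonneg (Real.rpow_nonneg hc.le _), ENNReal.ofReal_rpow_of_pos hc,
      ← ENNReal.ofReal_mul (Real.rpow_nonneg hc.le _), ← Real.rpow_add hc]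
    simp
  have hae : ∀ {P : Y → Prop}, (∀ᵐ y ∂ν, P y) → ∀ᵐ x ∂μ, x ∈ s → P (φ x) := by
    intro P hP
    rw [← ae_restrict_iff' hs]
    refine ae_of_ae_map hφ.aemeasurable ?_
    rw [hmap]
    exact Measure.ae_smul_measure hP _
  have hsm : ∀ g : Lp 𝕜 p ν, AEStronglyMeasurable g ((μ.restrict s).map φ) := fun g => by
    rw [hmap]
    exact (Lp.aestronglyMeasurable g).smul_measure _
  have hnorm : ∀ g : Lp 𝕜 p ν,
      eLpNorm (s.indicator fun x => κ * g (φ x)) p μ = eLpNorm g p ν := by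
    intro g
    rw [eLpNorm_indicator_eq_eLpNorm_restrict hs,
      show (fun x => κ * g (φ x)) = κ • (g ∘ φ) from rfl, eLpNorm_const_smul,
      ← eLpNorm_map_measure (hsm g) hφ.aemeasurable, hmap,
      eLpNorm_smul_measure_of_ne_top hp, smul_eq_mul, ENNReal.toReal_div, ENNReal.toReal_one,
      ← mul_assoc, hκn, one_mul]
  have hmem : ∀ g : Lp 𝕜 p ν, MemLp (s.indicator fun x => κ * g (φ x)) p μ := fun g =>
    ⟨(aestronglyMeasurable_indicator_iff hs).2
      (((hsm g).comp_aemeasurable hφ.aemeasurable).const_mul κ),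
      (hnorm g).trans_lt (Lp.eLpNorm_lt_top g)⟩
  refine ⟨⟨⟨⟨fun g => (hmem g).toLp _, fun f g => ?_⟩, fun a g => ?_⟩, fun g => ?_⟩⟩
  · rw [← MemLp.toLp_add]
    refine MemLp.toLp_congr _ _ ?_
    filter_upwards [hae (Lp.coeFn_add f g)] with x hx
    by_cases hxs : x ∈ s
    · have h2 := hx hxs
      simp only [Pi.add_apply, Set.indicator_of_mem hxs] at h2 ⊢
      rw [h2, mul_add]
    · simp [hxs]
  · rw [RingHom.id_apply, ← MemLp.toLp_const_smul]
    refine MemLp.toLp_congr (hmem (a • g)) _ ?_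
    filter_upwards [hae (Lp.coeFn_smul a g)] with x hx
    by_cases hxs : x ∈ s
    · have h2 := hx hxs
      simp only [Pi.smul_apply, Set.indicator_of_mem hxs, smul_eq_mul] at h2 ⊢
      rw [h2, mul_left_comm]
    · simp [hxs]
  · change ‖(hmem g).toLp _‖ = ‖g‖
    rw [Lp.norm_toLp, hnorm, Lp.norm_def]

end Embedding

/-! ### Embedding of the unit interval through a gapless cell. -/

namespace OrderLine

variable {L : Type*} {h : L → ℝ}

/-- The σ-algebra may be smaller than the Borel one, but where the values of `h` are dense, an
initial segment of the cell is a countable union of cells. -/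
theorem measurableSet_cell_inter_lt [Countable L] {a b : L}
    (hd : ∀ x y, h a ≤ x → x < y → y ≤ h b → ∃ c, x < h c ∧ h c ≤ y) (y : ℝ) :
    MeasurableSet (cell h a b ∩ {ω | ω.val < y}) := by
  rcases lt_or_ge (h b) y with hy | hy
  · convert measurableSet_cell h a b using 1
    exact Set.inter_eq_left.2 fun ω hω => hω.2.trans hy
  · have heq : cell h a b ∩ {ω | ω.val < y} = ⋃ c : {c : L // h c ≤ y}, cell h a c := by
      ext ω
      simp only [Set.mem_inter_iff, Set.mem_ofPred_eq, Set.mem_iUnion]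
      constructor
      · rintro ⟨h1, h2⟩
        obtain ⟨c, hc1, hc2⟩ := hd ω.val y h1.1 h2 hy
        exact ⟨⟨c, hc2⟩, h1.1, hc1⟩
      · rintro ⟨⟨c, hc⟩, h1⟩
        exact ⟨⟨h1.1, h1.2.trans_le (hc.trans hy)⟩, h1.2.trans_le hc⟩
    rw [heq]
    exact MeasurableSet.iUnion fun c => measurableSet_cell h a c

/-- Indexing by `Lᵒᵈ × L` makes the family of cells increasing and directed, as
`indicatorConstLp_mem_of_monotone` requires. -/
theorem measure_compl_iUnion_cell [Countable L] :
    measure h (Set.univ \ ⋃ ab : Lᵒᵈ × L, cell h (OrderDual.ofDual ab.1) ab.2) = 0 := by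
  have : Countable Lᵒᵈ := ‹Countable L›
  rw [measure_apply h (MeasurableSet.univ.diff
    (MeasurableSet.iUnion fun ab => measurableSet_cell h _ _))]
  convert measure_empty (μ := (volume : Measure ℝ))
  refine Set.eq_empty_of_forall_notMem fun x hx => hx.1.2 ?_
  obtain ⟨ab, hab⟩ := Set.mem_iUnion.1 hx.2
  exact Set.mem_iUnion.2 ⟨(OrderDual.toDual ab.1, ab.2), hab⟩

variable [LinearOrder L]

/-- If `h` had no value in `(x, y]`, the cut at `x` would have gap at least `y - x` and hence be an
adjacency. It would lie between the points `0` and `1` of the copy of `ℚ`, thus inside `J` by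
convexity, against the density of `ℚ`. -/
theorem exists_dense_interval (hm : StrictMono h) (hgap : GapsAreAdjacencies h)
    (hQ : HasRationalInterval L) : ∃ a b : L, a < b ∧
      ∀ x y, h a ≤ x → x < y → y ≤ h b → ∃ c, x < h c ∧ h c ≤ y := by
  obtain ⟨J, hJ, ⟨i⟩⟩ := hQ
  have hab : (i.symm 0 : L) < i.symm 1 := i.symm.strictMono zero_lt_one
  refine ⟨i.symm 0, i.symm 1, hab, fun x y hx hxy hy => ?_⟩
  by_contra! hno
  obtain ⟨a, ha, b, hb, hcov⟩ := hgap {c | h c ≤ x} (y - x) (sub_pos.2 hxy)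
    (fun c d hdc hc => (hm.monotone hdc).trans hc) ⟨_, hx⟩
    ⟨(i.symm 1 : L), fun hc => (hxy.trans_le hy).not_ge hc⟩ (by
      intro a ha b hb
      have h1 := hno b (lt_of_not_ge hb)
      have h2 : h a ≤ x := ha
      linarith)
  have hb' : x < h b := lt_of_not_ge hb
  have ha1 : (i.symm 0 : L) ≤ a :=
    hcov.le_of_lt (hm.lt_iff_lt.1 (hx.trans_lt hb'))
  have hb1 : b ≤ (i.symm 1 : L) :=
    hcov.ge_of_gt (hm.lt_iff_lt.1 (lt_of_le_of_lt ha (hxy.trans_le hy)))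
  have haJ : a ∈ J := hJ.out (i.symm 0).2 (i.symm 1).2 ⟨ha1, hcov.le.trans hb1⟩
  have hbJ : b ∈ J := hJ.out (i.symm 0).2 (i.symm 1).2 ⟨ha1.trans hcov.le, hb1⟩
  have hlt : i ⟨a, haJ⟩ < i ⟨b, hbJ⟩ := i.strictMono hcov.lt
  obtain ⟨q, hq1, hq2⟩ := exists_between hlt
  have h1 : (⟨a, haJ⟩ : J) < i.symm q := by simpa using i.symm.strictMono hq1
  have h2 : i.symm q < (⟨b, hbJ⟩ : J) := by simpa using i.symm.strictMono hq2
  exact hcov.2 h1 h2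

open Classical in
/-- The affine map from `[h a, h b)` onto `[0, 1)`, extended by `0`. -/
noncomputable def toUnit (h : L → ℝ) (a b : L) (ω : OrderLine h) : ℝ :=
  if ω ∈ cell h a b then (ω.val + -h a) * (h b - h a)⁻¹ else 0

theorem measurable_toUnit [Countable L] (hm : StrictMono h) {a b : L} (hab : a < b)
    (hd : ∀ x y, h a ≤ x → x < y → y ≤ h b → ∃ c, x < h c ∧ h c ≤ y) :
    Measurable (toUnit h a b) := by
  have hl : 0 < h b - h a := sub_pos.2 (hm hab)
  refine measurable_of_Iio fun t => ?_
  have heq : toUnit h a b ⁻¹' Set.Iio t =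
      (cell h a b ∩ {ω | ω.val < h a + t * (h b - h a)}) ∪ ((cell h a b)ᶜ ∩ {_ω | 0 < t}) := by
    ext ω
    by_cases hω : ω ∈ cell h a b
    · simp only [toUnit, hω, Set.mem_preimage, if_true, Set.mem_Iio, Set.mem_union,
        Set.mem_inter_iff, Set.mem_ofPred_eq, true_and, Set.mem_compl_iff, not_true, false_and,
        or_false]
      rw [← div_eq_mul_inv, div_lt_iff₀ hl]
      constructor <;> intro h' <;> linarith
    · simp [toUnit, hω]
  rw [heq]
  exact (measurableSet_cell_inter_lt hd _).union
    ((measurableSet_cell h a b).compl.inter (MeasurableSet.const _))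

theorem map_toUnit [Countable L] (hm : StrictMono h) {a b : L} (hab : a < b)
    (hd : ∀ x y, h a ≤ x → x < y → y ≤ h b → ∃ c, x < h c ∧ h c ≤ y) :
    ((measure h).restrict (cell h a b)).map (toUnit h a b) =
      ENNReal.ofReal (h b - h a) • volume.restrict (Set.Icc (0 : ℝ) 1) := by
  have hl : 0 < h b - h a := sub_pos.2 (hm hab)
  have hmk : mk h ⁻¹' cell h a b = Set.Ico (h a) (h b) := rfl
  have hA : Measurable fun x : ℝ => (x + -h a) * (h b - h a)⁻¹ := by fun_prop
  have hpre : (fun x : ℝ => (x + -h a) * (h b - h a)⁻¹) ⁻¹' Set.Ico 0 1 = Set.Ico (h a) (h b) := by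
    ext x
    simp only [Set.mem_preimage, Set.mem_Ico, ← div_eq_mul_inv]
    rw [le_div_iff₀ hl, div_lt_iff₀ hl]
    constructor <;> rintro ⟨h1, h2⟩ <;> constructor <;> linarith
  have hvol : (volume : Measure ℝ).map (fun x : ℝ => (x + -h a) * (h b - h a)⁻¹) =
      ENNReal.ofReal (h b - h a) • volume := by
    rw [show (fun x : ℝ => (x + -h a) * (h b - h a)⁻¹) =
      (· * (h b - h a)⁻¹) ∘ (· + -h a) from rfl,
      ← Measure.map_map (by fun_prop) (by fun_prop), map_add_right_eq_self,
      Real.map_volume_mul_right (inv_ne_zero hl.ne'), inv_inv, abs_of_pos hl]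
  rw [measure, Measure.restrict_map (measurable_mk h) (measurableSet_cell h a b),
    Measure.map_map (measurable_toUnit hm hab hd) (measurable_mk h), hmk,
    Measure.restrict_restrict measurableSet_Ico, Set.inter_eq_left.2 (Ico_subset_hull h a b)]
  have hcongr : toUnit h a b ∘ mk h =ᵐ[volume.restrict (Set.Ico (h a) (h b))]
      fun x : ℝ => (x + -h a) * (h b - h a)⁻¹ := by
    filter_upwards [ae_restrict_mem measurableSet_Ico] with x hx
    exact if_pos hx
  rw [Measure.map_congr hcongr, ← hpre, ← Measure.restrict_map hA measurableSet_Ico, hvol,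
    Measure.restrict_smul, restrict_Ico_eq_restrict_Icc]

theorem nonempty_embedding {𝕜 : Type*} [RCLike 𝕜] [Countable L] (hm : StrictMono h)
    (hgap : GapsAreAdjacencies h) {p : ℝ≥0∞} [Fact (1 ≤ p)] (hp : p ≠ ∞)
    (hQ : HasRationalInterval L) :
    Nonempty (Lp 𝕜 p (volume.restrict (Set.Icc (0 : ℝ) 1)) →ₗᵢ[𝕜] Lp 𝕜 p (measure h)) := by
  obtain ⟨a, b, hab, hd⟩ := exists_dense_interval hm hgap hQ
  exact nonempty_linearIsometry_of_map_restrict hp (measurableSet_cell h a b)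
    (measurable_toUnit hm hab hd) (sub_pos.2 (hm hab)) (map_toUnit hm hab hd)

end OrderLine

/-! ### Density -/

section Density

variable {𝕜 : Type*} [RCLike 𝕜] {X : Type*} [MeasurableSpace X] {μ : Measure X} [IsFiniteMeasure μ]
  {p : ℝ≥0∞} [Fact (1 ≤ p)]

/-- The measure of `u \ t i` tends to zero, and for finite `p` this means convergence of the
indicators in `Lp`. -/
theorem indicatorConstLp_mem_of_monotone (hp : p ≠ ∞) {K : Set (Lp 𝕜 p μ)} (hK : IsClosed K)
    {ι : Type*} [Preorder ι] [Nonempty ι] [IsDirectedOrder ι] [Countable ι] {t : ι → Set X}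
    (ht : ∀ i, MeasurableSet (t i)) (hmono : Monotone t) {u : Set X} (hu : MeasurableSet u)
    (htu : ∀ i, t i ⊆ u) (hdiff : μ (u \ ⋃ i, t i) = 0)
    (hmem : ∀ i, indicatorConstLp p (ht i) (measure_ne_top μ _) (1 : 𝕜) ∈ K) :
    indicatorConstLp p hu (measure_ne_top μ _) (1 : 𝕜) ∈ K := by
  have h1 : Filter.Tendsto (fun i => μ (u \ t i)) Filter.atTop (nhds 0) := by
    have h2 := tendsto_measure_iInter_atTop (μ := μ) (s := fun i => u \ t i)
      (fun i => (hu.diff (ht i)).nullMeasurableSet)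
      (fun i j hij => Set.sdiff_subset_sdiff_right (hmono hij))
      ⟨Classical.arbitrary ι, measure_ne_top _ _⟩
    rwa [← Set.sdiff_iUnion, hdiff] at h2
  refine hK.mem_of_tendsto (b := Filter.atTop) (tendsto_indicatorConstLp_set (ht := ht) (hs := hu)
    (hμt := fun i => measure_ne_top μ _) (hμs := measure_ne_top μ _) hp ?_)
    (Filter.Eventually.of_forall hmem)
  refine h1.congr fun i => ?_
  rw [Set.symmDiff_def, Set.sdiff_eq_empty.2 (htu i), Set.empty_union]

theorem eq_top_of_indicatorConstLp_mem (hp : p ≠ ∞) {K : Submodule 𝕜 (Lp 𝕜 p μ)}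
    (hK : IsClosed (K : Set (Lp 𝕜 p μ)))
    (hmem : ∀ s (hs : MeasurableSet s), indicatorConstLp p hs (measure_ne_top μ _) (1 : 𝕜) ∈ K) :
    K = ⊤ := by
  refine eq_top_iff.2 fun f _ => ?_
  refine Lp.induction hp (motive := fun f => f ∈ K) (fun c s hs hμs => ?_)
    (fun f g hf hg _ hfK hgK => K.add_mem hfK hgK) hK f
  rw [Lp.simpleFunc.coe_indicatorConst]
  have hc : indicatorConstLp p hs hμs.ne c =
      c • indicatorConstLp p hs (measure_ne_top μ _) (1 : 𝕜) := by
    rw [indicatorConstLp, indicatorConstLp, ← MemLp.toLp_const_smul]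
    refine MemLp.toLp_congr _ _ (Filter.Eventually.of_forall fun x => ?_)
    by_cases hx : x ∈ s <;> simp [hx]
  rw [hc]
  exact K.smul_mem _ (hmem s hs)

/-- The sets whose indicators lie in `K` form a λ-system. -/
theorem indicatorConstLp_mem_of_piSystem (hp : p ≠ ∞) {K : Submodule 𝕜 (Lp 𝕜 p μ)}
    (hK : IsClosed (K : Set (Lp 𝕜 p μ))) {C : Set (Set X)}
    (hC : ‹MeasurableSpace X› = MeasurableSpace.generateFrom C) (hpi : IsPiSystem C)
    (huniv : indicatorConstLp p MeasurableSet.univ (measure_ne_top μ _) (1 : 𝕜) ∈ K)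
    (hmem : ∀ s ∈ C, ∀ hs : MeasurableSet s,
      indicatorConstLp p hs (measure_ne_top μ _) (1 : 𝕜) ∈ K) (s : Set X) (hs : MeasurableSet s) :
    indicatorConstLp p hs (measure_ne_top μ _) (1 : 𝕜) ∈ K := by
  induction s, hs using MeasurableSpace.induction_on_inter hC hpi with
  | empty =>
    rw [indicatorConstLp_empty]
    exact K.zero_mem
  | basic t ht => exact hmem t ht _
  | compl t htm ih =>
    have h1 := indicatorConstLp_disjoint_union (p := p) htm htm.compl (measure_ne_top μ _)
      (measure_ne_top μ _) disjoint_compl_right (1 : 𝕜)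
    simp only [Set.union_compl_self] at h1
    rw [h1] at huniv
    exact (K.add_mem_iff_right ih).1 huniv
  | iUnion t hd htm ih =>
    have hacc : ∀ n, MeasurableSet (Set.accumulate t n) := fun n =>
      MeasurableSet.biUnion (Set.to_countable _) fun i _ => htm i
    have key : ∀ n, indicatorConstLp p (hacc n) (measure_ne_top μ _) (1 : 𝕜) ∈ K := by
      intro n
      induction n with
      | zero =>
        simp only [Set.accumulate_zero_nat]
        exact ih 0
      | succ n ihn =>
        simp only [Set.accumulate_succ]
        rw [indicatorConstLp_disjoint_union (hacc n) (htm (n + 1)) (measure_ne_top μ _)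
          (measure_ne_top μ _) (Set.disjoint_accumulate hd (Nat.lt_succ_self n))]
        exact K.add_mem ihn (ih _)
    refine indicatorConstLp_mem_of_monotone hp hK hacc Set.monotone_accumulate _
      (fun n => ?_) ?_ key
    · rw [← Set.iUnion_accumulate]
      exact Set.subset_iUnion _ n
    · rw [Set.iUnion_accumulate, Set.sdiff_self, measure_empty]

end Density

/-! ### Density of the span of the indicators of cells. -/

namespace OrderLine

variable {L : Type*} [LinearOrder L] {h : L → ℝ}

theorem isPiSystem_cells (hm : StrictMono h) :
    IsPiSystem (Set.range fun ab : L × L => cell h ab.1 ab.2) := by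
  rintro _ ⟨⟨a, b⟩, rfl⟩ _ ⟨⟨c, d⟩, rfl⟩ -
  refine ⟨(max a c, min b d), ?_⟩
  ext ω
  simp only [cell, Set.mem_ofPred_eq, Set.mem_inter_iff, Set.mem_Ico, hm.monotone.map_max,
    hm.monotone.map_min, max_le_iff, lt_min_iff]
  tauto

/-- The cells need not include the whole line, so its indicator is obtained separately as a limit:
the line is, up to a null set, a directed union of cells. For empty `L` the measure is zero. -/
theorem eq_top_of_cell_mem {𝕜 : Type*} [RCLike 𝕜] [Countable L] (hm : StrictMono h) {p : ℝ≥0∞}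
    [Fact (1 ≤ p)] (hp : p ≠ ∞) [IsFiniteMeasure (measure h)]
    {K : Submodule 𝕜 (Lp 𝕜 p (measure h))} (hK : IsClosed (K : Set (Lp 𝕜 p (measure h))))
    (hmem : ∀ a b : L, a ≤ b → indicatorConstLp p (measurableSet_cell h a b)
      (measure_ne_top (measure h) _) (1 : 𝕜) ∈ K) : K = ⊤ := by
  have hmem' : ∀ a b : L, indicatorConstLp p (measurableSet_cell h a b)
      (measure_ne_top (measure h) _) (1 : 𝕜) ∈ K := by
    intro a b
    rcases le_total a b with hab | hab
    · exact hmem a b hab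
    · have : cell h a b = ∅ := Set.eq_empty_of_forall_notMem fun ω hω =>
        (hω.1.trans_lt hω.2).not_ge (hm.monotone hab)
      simp only [this, indicatorConstLp_empty]
      exact K.zero_mem
  refine eq_top_of_indicatorConstLp_mem hp hK
    (indicatorConstLp_mem_of_piSystem hp hK rfl (isPiSystem_cells hm) ?_ ?_)
  · rcases isEmpty_or_nonempty L with hL | hL
    · have h0 : measure h Set.univ = 0 := by
        have := measure_compl_iUnion_cell (h := h)
        rwa [Set.iUnion_of_empty, Set.sdiff_empty] at this
      have : indicatorConstLp p MeasurableSet.univ (measure_ne_top (measure h) _) (1 : 𝕜) = 0 := by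
        exact Lp.eq_zero_iff_ae_eq_zero.2
          (ae_iff.2 (measure_mono_null (Set.subset_univ _) h0))
      rw [this]
      exact K.zero_mem
    · have : Countable Lᵒᵈ := ‹Countable L›
      refine indicatorConstLp_mem_of_monotone (ι := Lᵒᵈ × L) hp hK
        (t := fun ab => cell h (OrderDual.ofDual ab.1) ab.2)
        (fun ab => measurableSet_cell h _ _) ?_ _ (fun _ => Set.subset_univ _)
        measure_compl_iUnion_cell fun ab => hmem' _ _
      rintro ⟨a, b⟩ ⟨c, d⟩ ⟨hca, hbd⟩ ω hω
      exact ⟨(hm.monotone hca).trans hω.1, hω.2.trans_le (hm.monotone hbd)⟩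
  · rintro _ ⟨⟨a, b⟩, rfl⟩ _
    exact hmem' a b

end OrderLine

/-! ### The norm of step functions -/

section StepFunction

variable {𝕜 : Type*} [RCLike 𝕜]

theorem lintegral_step (g : ℕ → ℝ≥0∞) {M : ℕ} (hM : 0 < M) (n : ℕ) :
    ∫⁻ x in Set.Ico (0 : ℝ) (n / M), g ⌊x * M⌋₊ =
      ∑ i ∈ Finset.range n, g i * ENNReal.ofReal (1 / M) := by
  have hM' : (0 : ℝ) < M := by exact_mod_cast hM
  induction n with
  | zero => simp
  | succ n ih =>
    have h1 : (0 : ℝ) ≤ n / M := by positivity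
    have h2 : (n / M : ℝ) ≤ (n + 1 : ℕ) / M := by gcongr; simp
    rw [← Set.Ico_union_Ico_eq_Ico h1 h2, lintegral_union measurableSet_Ico
      (Set.Ico_disjoint_Ico_same), ih, Finset.sum_range_succ]
    congr 1
    have h3 : ∀ x ∈ Set.Ico (n / M : ℝ) ((n + 1 : ℕ) / M), g ⌊x * M⌋₊ = g n := by
      intro x hx
      rw [Set.mem_Ico, div_le_iff₀ hM', lt_div_iff₀ hM'] at hx
      rw [(Nat.floor_eq_iff (n.cast_nonneg.trans hx.1)).2 ⟨hx.1, by exact_mod_cast hx.2⟩]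
    rw [setLIntegral_congr_fun measurableSet_Ico h3, setLIntegral_const, Real.volume_Ico]
    congr 2
    push_cast
    ring

theorem toReal_eLpNorm_step {p : ℝ} (hp : 0 < p) (g : ℕ → 𝕜) {M : ℕ} (hM : 0 < M) :
    (eLpNorm (fun x : ℝ => g ⌊x * M⌋₊) (ENNReal.ofReal p)
      (volume.restrict (Set.Ico 0 1))).toReal ^ p * M = ∑ i ∈ Finset.range M, ‖g i‖ ^ p := by
  have hM' : (0 : ℝ) < M := by exact_mod_cast hM
  have h1 := lintegral_step (fun i => ‖g i‖ₑ ^ p) hM M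
  rw [div_self hM'.ne'] at h1
  rw [eLpNorm_eq_lintegral_rpow_enorm_toReal (by simpa using hp) ENNReal.ofReal_ne_top,
    ENNReal.toReal_ofReal hp.le, h1, ← ENNReal.toReal_rpow, ← Real.rpow_mul ENNReal.toReal_nonneg,
    one_div_mul_cancel hp.ne', Real.rpow_one, ENNReal.toReal_sum, Finset.sum_mul]
  · refine Finset.sum_congr rfl fun i _ => ?_
    rw [ENNReal.toReal_mul, ← ENNReal.toReal_rpow, toReal_enorm,
      ENNReal.toReal_ofReal (by positivity), mul_assoc, one_div_mul_cancel hM'.ne', mul_one]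
  · intro i _
    exact ENNReal.mul_ne_top (ENNReal.rpow_ne_top_of_nonneg hp.le enorm_ne_top)
      ENNReal.ofReal_ne_top

end StepFunction

/-! ### Values of rational vectors -/

section Values

variable (𝕜 : Type*) [RCLike 𝕜]

open Classical in
/-- Code of the squared modulus of the imaginary unit. -/
noncomputable def unitCode : QCode := if RCLike.im (RCLike.I : 𝕜) = 1 then (1, 0, 0) else (0, 0, 0)

theorem ratOfCode_unitCode :
    ((ratOfCode (unitCode 𝕜) : ℚ) : ℝ) = RCLike.im (RCLike.I : 𝕜) ^ 2 := by
  rcases RCLike.I_eq_zero_or_im_I_eq_one (K := 𝕜) with h | h <;> simp [unitCode, h, ratOfCode]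

theorem norm_sq_rat_add_rat_mul_I (x y : ℚ) :
    ‖((x : 𝕜) + (y : 𝕜) * RCLike.I : 𝕜)‖ ^ 2 =
      (x : ℝ) * x + RCLike.im (RCLike.I : 𝕜) ^ 2 * (y * y) := by
  have hx : (x : 𝕜) = ((x : ℝ) : 𝕜) := by simp
  have hy : (y : 𝕜) = ((y : ℝ) : 𝕜) := by simp
  rw [RCLike.norm_sq_eq_def, hx, hy]
  simp only [map_add, RCLike.ofReal_re, RCLike.ofReal_im, RCLike.re_ofReal_mul,
    RCLike.im_ofReal_mul, RCLike.I_re]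
  ring

/-- The value on the `i`-th cell of the vector with coefficients `l`. -/
noncomputable def cellValue (s : List Bool) (x : List ℕ) (l : List ScalarCode) (i : ℕ) : 𝕜 :=
  ∑ j ∈ Finset.range l.length,
    if CellMem s x i j then scalarOfCode 𝕜 (l.getD j ((0, 0, 0), (0, 0, 0))) else 0

theorem ratOfCode_sum_map_range (n : ℕ) (f : ℕ → QCode) :
    ratOfCode (QCode.sum ((List.range n).map f)) = ∑ i ∈ Finset.range n, ratOfCode (f i) := by
  rw [ratOfCode_sum]
  induction n with
  | zero => simp
  | succ n ih => simp [List.range_succ, Finset.sum_range_succ, ← ih]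

theorem ratOfCode_cellNormSq (s : List Bool) (x : List ℕ) (l : List ScalarCode) (i : ℕ) :
    ((ratOfCode (cellNormSq (unitCode 𝕜) s x l i) : ℚ) : ℝ) = ‖cellValue 𝕜 s x l i‖ ^ 2 := by
  have h : cellValue 𝕜 s x l i = ((ratOfCode (cellRe s x l i) : ℚ) : 𝕜) +
      ((ratOfCode (cellIm s x l i) : ℚ) : 𝕜) * RCLike.I := by
    rw [cellRe, cellIm, ratOfCode_sum_map_range, ratOfCode_sum_map_range, cellValue]
    push_cast
    rw [Finset.sum_mul, ← Finset.sum_add_distrib]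
    refine Finset.sum_congr rfl fun j _ => ?_
    split_ifs
    · rfl
    · simp [ratOfCode]
  rw [h, norm_sq_rat_add_rat_mul_I, ← ratOfCode_unitCode, cellNormSq]
  simp only [ratOfCode_add, ratOfCode_mul]
  push_cast
  rfl

end Values

/-! ### The presentation -/

namespace OrderLine

variable {L : Type*} {e : L ↪ ℕ} {f : ℕ → Bool}

/-- The positions of the elements of an order with diagram `f`. -/
noncomputable abbrev height (e : L ↪ ℕ) (f : ℕ → Bool) (a : L) : ℝ := position f (e a)

/-- Reals in the support of the `j`-th distinguished point. -/
def supportReal (f : ℕ → Bool) (j : ℕ) : Set ℝ :=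
  {x | f j = true ∧ x ∈ Set.Ico (position f j.unpair.1) (position f j.unpair.2)}

/-- The support of the `j`-th distinguished point. -/
def support (e : L ↪ ℕ) (f : ℕ → Bool) (j : ℕ) : Set (OrderLine (height e f)) :=
  {ω | ω.val ∈ supportReal f j}

theorem support_pair (a b : L) (hab : f (Nat.pair (e a) (e b)) = true) :
    support e f (Nat.pair (e a) (e b)) = cell (height e f) a b := by
  ext ω
  simp [support, supportReal, cell, hab]

variable [LinearOrder L]

theorem support_eq (hf : IsDiagramBy e f) (j : ℕ) :
    support e f j = ∅ ∨ ∃ a b, support e f j = cell (height e f) a b := by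
  by_cases h : f j = true
  · have h' := h
    rw [← Nat.pair_unpair j] at h'
    obtain ⟨a, b, ha, hb, -⟩ := (hf _ _).1 h'
    refine Or.inr ⟨a, b, ?_⟩
    rw [← support_pair a b (by rwa [ha, hb]), ha, hb, Nat.pair_unpair]
  · exact Or.inl (Set.eq_empty_of_forall_notMem fun ω hω => h hω.1)

theorem measurableSet_support (hf : IsDiagramBy e f) (j : ℕ) : MeasurableSet (support e f j) := by
  rcases support_eq hf j with h | ⟨a, b, h⟩ <;> rw [h]
  · exact MeasurableSet.empty
  · exact measurableSet_cell _ a b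

theorem isFiniteMeasure_height (hf : IsDiagramBy e f) : IsFiniteMeasure (measure (height e f)) :=
  isFiniteMeasure _ (position_mem_Ioo hf)

theorem supportReal_subset (hf : IsDiagramBy e f) (j : ℕ) :
    supportReal f j ⊆ hull (height e f) := by
  intro x hx
  rcases support_eq hf j with h | ⟨a, b, h⟩
  · exact absurd (show mk (height e f) x ∈ support e f j from hx) (by simp [h])
  · exact Ico_subset_hull (height e f) a b
      (show mk (height e f) x ∈ cell (height e f) a b from h ▸ hx)

/-- The presentation of `Lp` with the indicator functions of intervals as distinguished points. -/
noncomputable def presentation (𝕜 : Type*) [RCLike 𝕜] (p : ℝ≥0∞) [Fact (1 ≤ p)] (hp : p ≠ ∞)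
    (hf : IsDiagramBy e f) : Presentation 𝕜 (Lp 𝕜 p (measure (height e f))) where
  point j :=
    have := isFiniteMeasure_height hf
    indicatorConstLp p (measurableSet_support hf j) (measure_ne_top _ _) (1 : 𝕜)
  linearlyDense := by
    have := isFiniteMeasure_height hf
    have : Countable L := e.injective.countable
    set K := Submodule.span 𝕜 (Set.range fun j =>
      indicatorConstLp p (measurableSet_support hf j) (measure_ne_top (measure (height e f)) _)
        (1 : 𝕜)) with hK
    have h := eq_top_of_cell_mem (strictMono_position hf) hp (K := K.topologicalClosure)
      K.isClosed_topologicalClosure fun a b hab => K.le_topologicalClosure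
        (Submodule.subset_span ⟨Nat.pair (e a) (e b), ?_⟩)
    · rw [← Submodule.topologicalClosure_coe, h, Submodule.top_coe]
    · simp only [support_pair a b ((diagram_pair_iff hf a b).2 hab)]

/-! ### Norms of rational vectors as finite sums. -/

section Norm

variable {𝕜 : Type*} [RCLike 𝕜] {p : ℝ} [Fact (1 ≤ p)]

open Classical in
/-- The function on the real line which represents the vector with coefficients `l`. -/
noncomputable def lineValue (𝕜 : Type*) [RCLike 𝕜] (f : ℕ → Bool) (l : List ScalarCode)
    (x : ℝ) : 𝕜 :=
  ∑ j ∈ Finset.range l.length,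
    if x ∈ supportReal f j then scalarOfCode 𝕜 (l.getD j ((0, 0, 0), (0, 0, 0))) else 0

theorem lineValue_eq_zero (hf : IsDiagramBy e f) (l : List ScalarCode) {x : ℝ}
    (hx : x ∉ hull (height e f)) : lineValue 𝕜 f l x = 0 :=
  Finset.sum_eq_zero fun j _ => if_neg fun h => hx (supportReal_subset hf j h)

/-- Both components of `j.unpair` are at most `j`, so the first `N` distinguished points involve
only positions of numbers below `N`. These are multiples of `2⁻ᴺ`, and comparing them with `x` only
needs the floor of `x * 2 ^ N`. -/
theorem lineValue_eq_cellValue (l : List ScalarCode) {x : ℝ} (hx : 0 ≤ x) :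
    lineValue 𝕜 f l x = cellValue 𝕜 (initialSegment f (l.length * l.length))
      (positions (initialSegment f (l.length * l.length)) l.length) l
        ⌊x * (2 ^ l.length : ℕ)⌋₊ := by
  classical
  have h2 : (0 : ℝ) < 2 ^ l.length := by positivity
  refine Finset.sum_congr rfl fun j hj => ?_
  have hj' := Finset.mem_range.1 hj
  have hpos : ∀ i < l.length, ((positions (initialSegment f (l.length * l.length))
      l.length).getD i 0 : ℝ) = position f i * 2 ^ l.length := fun i hi =>
    getD_positions f _ hi fun _ => getD_initialSegment f
  have hx0 : 0 ≤ x * (2 ^ l.length : ℕ) := by positivity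
  refine if_congr ?_ rfl rfl
  rw [CellMem, getD_initialSegment f (by nlinarith), Nat.le_floor_iff hx0, Nat.floor_lt hx0,
    hpos _ ((Nat.unpair_left_le j).trans_lt hj'), hpos _ ((Nat.unpair_right_le j).trans_lt hj')]
  push_cast
  rw [mul_le_mul_iff_left₀ h2, mul_lt_mul_iff_left₀ h2]
  rfl

theorem coeFn_rationalVector (hf : IsDiagramBy e f) {p : ℝ≥0∞} [Fact (1 ≤ p)] (hp : p ≠ ∞) (m : ℕ) :
    (presentation 𝕜 p hp hf).rationalVector m =ᵐ[measure (height e f)]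
      fun ω => lineValue 𝕜 f (coefficients m) ω.val := by
  classical
  have := isFiniteMeasure_height hf
  have h1 : (presentation 𝕜 p hp hf).rationalVector m =
      ∑ j ∈ Finset.range (coefficients m).length,
        scalarOfCode 𝕜 ((coefficients m).getD j ((0, 0, 0), (0, 0, 0))) •
          indicatorConstLp p (measurableSet_support hf j) (measure_ne_top _ _) (1 : 𝕜) := by
    rw [Finset.sum_range]
    refine Finset.sum_congr rfl fun j _ => ?_
    congr 2
    exact (List.getD_eq_getElem _ _ j.2).symm
  rw [h1]
  have h2 : ∀ n : ℕ, ((∑ j ∈ Finset.range n,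
        scalarOfCode 𝕜 ((coefficients m).getD j ((0, 0, 0), (0, 0, 0))) •
          indicatorConstLp p (measurableSet_support hf j) (measure_ne_top _ _) (1 : 𝕜) :
          Lp 𝕜 p (measure (height e f))) : OrderLine (height e f) → 𝕜)
      =ᵐ[measure (height e f)] fun ω => ∑ j ∈ Finset.range n,
        if ω.val ∈ supportReal f j then
          scalarOfCode 𝕜 ((coefficients m).getD j ((0, 0, 0), (0, 0, 0))) else 0 := by
    intro n
    induction n with
    | zero =>
      simp only [Finset.range_zero, Finset.sum_empty]
      exact Lp.coeFn_zero _ _ _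
    | succ n ih =>
      simp only [Finset.sum_range_succ]
      filter_upwards [Lp.coeFn_add (∑ j ∈ Finset.range n,
        scalarOfCode 𝕜 ((coefficients m).getD j ((0, 0, 0), (0, 0, 0))) •
          indicatorConstLp p (measurableSet_support hf j) (measure_ne_top _ _) (1 : 𝕜))
        (scalarOfCode 𝕜 ((coefficients m).getD n ((0, 0, 0), (0, 0, 0))) •
          indicatorConstLp p (measurableSet_support hf n) (measure_ne_top _ _) (1 : 𝕜)), ih,
        Lp.coeFn_smul (scalarOfCode 𝕜 ((coefficients m).getD n ((0, 0, 0), (0, 0, 0))))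
          (indicatorConstLp p (measurableSet_support hf n)
            (measure_ne_top (measure (height e f)) _) (1 : 𝕜)),
        indicatorConstLp_coeFn (p := p) (hs := measurableSet_support hf n)
          (hμs := measure_ne_top (measure (height e f)) _) (c := (1 : 𝕜))] with ω h3 h4 h5 h6
      rw [h3, Pi.add_apply, h4, h5, Pi.smul_apply, h6, Set.indicator_apply]
      congr 1
      by_cases hω : ω.val ∈ supportReal f n
      · rw [if_pos hω, if_pos (show ω ∈ support e f n from hω), smul_eq_mul, mul_one]
      · rw [if_neg hω, if_neg (show ω ∉ support e f n from hω), smul_zero]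
  exact h2 _

theorem norm_of_ae_eq_lineValue (hf : IsDiagramBy e f) (l : List ScalarCode)
    {R : Lp 𝕜 (ENNReal.ofReal p) (measure (height e f))}
    (hR : R =ᵐ[measure (height e f)] fun ω => lineValue 𝕜 f l ω.val) :
    ‖R‖ ^ p * (2 ^ l.length : ℕ) = ∑ i ∈ Finset.range (2 ^ l.length),
      ‖cellValue 𝕜 (initialSegment f (l.length * l.length))
        (positions (initialSegment f (l.length * l.length)) l.length) l i‖ ^ p := by
  have hp : 1 ≤ p := Fact.out
  have : Countable L := e.injective.countable
  rw [← toReal_eLpNorm_step (by linarith) _ (by positivity)]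
  congr 2
  rw [Lp.norm_def]
  congr 1
  have h1 : AEStronglyMeasurable (fun ω => lineValue 𝕜 f l ω.val)
      (measure (height e f)) := (Lp.aestronglyMeasurable R).congr hR
  have hsub : hull (height e f) ⊆ Set.Ico 0 1 := hull_subset_Ico _ (position_mem_Ioo hf)
  have h2 : ∀ s : Set ℝ, hull (height e f) ⊆ s →
      s.indicator (lineValue 𝕜 f l) = lineValue 𝕜 f l := fun s hs =>
    Set.indicator_eq_self.2 fun x hx => hs (by
      by_contra h
      exact hx (lineValue_eq_zero hf _ h))
  rw [eLpNorm_congr_ae hR, measure, eLpNorm_map_measure h1 (measurable_mk _).aemeasurable,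
    ← eLpNorm_indicator_eq_eLpNorm_restrict (measurableSet_hull _)]
  -- The function vanishes off the hull, so the hull may be replaced by `[0, 1)`, which the dyadic
  -- intervals fill exactly.
  refine (congrArg (fun F => eLpNorm F _ _)
    ((h2 _ subset_rfl).trans (h2 _ hsub).symm)).trans ?_
  rw [eLpNorm_indicator_eq_eLpNorm_restrict measurableSet_Ico]
  refine eLpNorm_congr_ae ?_
  filter_upwards [ae_restrict_mem measurableSet_Ico] with x hx
  exact lineValue_eq_cellValue _ hx.1

end Norm

end OrderLine

/-! ### Correctness of the enumeration of the diagram -/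

section Diagram

theorem length_cellNormSqs (δ : QCode) (s : List Bool) (l : List ScalarCode) :
    (cellNormSqs δ s l).length = 2 ^ l.length := by simp [cellNormSqs]

theorem length_cellConst (x : QCode) (l : List ScalarCode) :
    (cellConst x l).length = 2 ^ l.length := by simp [cellConst]

theorem getD_cellNormSqs (δ : QCode) (s : List Bool) (l : List ScalarCode) {i : ℕ}
    (hi : i < 2 ^ l.length) : (cellNormSqs δ s l).getD i (0, 0, 0) =
      cellNormSq δ s (positions s l.length) l i := by
  simp [cellNormSqs, List.getD, hi]

theorem getD_cellConst (x : QCode) (l : List ScalarCode) {i : ℕ}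
    (hi : i < 2 ^ l.length) : (cellConst x l).getD i (0, 0, 0) = x := by
  simp [cellConst, List.getD, hi]

theorem mem_rationalInterval_iff (n : ℕ) (x : ℝ) : x ∈ rationalInterval n ↔
    ((ratOfCode (leftEnd n) : ℚ) : ℝ) < x ∧ x < ((ratOfCode (rightEnd n) : ℚ) : ℝ) := by
  have h : x ∈ rationalInterval n ↔ |x - ((ratOfCode (intervalCode n).1 : ℚ) : ℝ)| <
      (((intervalCode n).2.1 : ℝ) + 1) / (((intervalCode n).2.2 : ℝ) + 1) := Iff.rfl
  rw [h, abs_lt, leftEnd, rightEnd, ratOfCode_add, ratOfCode_add, ratOfCode_neg, ratOfCode_frac]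
  push_cast
  constructor <;> rintro ⟨h1, h2⟩ <;> constructor <;> linarith

/-- The check succeeds for some witness exactly when the norm is in the interval. -/
theorem exists_diagramCheck_iff {𝕜 : Type*} [RCLike 𝕜] {p x : ℝ} (hp : 0 < p) (hx : 0 ≤ x)
    {q : ℕ → QCode} (hq : ∀ k, |p - (ratOfCode (q k) : ℝ)| < (1 / 2 : ℝ) ^ k)
    {s : List Bool} {c : ℕ}
    (hsum : x ^ p * (2 ^ (coefficients c.unpair.1).length : ℕ) =
      ∑ i ∈ Finset.range (2 ^ (coefficients c.unpair.1).length),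
        ‖cellValue 𝕜 s (positions s (coefficients c.unpair.1).length)
          (coefficients c.unpair.1) i‖ ^ p) :
    (∃ w : DiagramWitness, DiagramCheck (unitCode 𝕜) s c w (q w.1.2)) ↔
      x ∈ rationalInterval c.unpair.2 := by
  rw [mem_rationalInterval_iff]
  simp only [DiagramCheck]
  generalize coefficients c.unpair.1 = l at hsum ⊢
  generalize rightEnd c.unpair.2 = R
  generalize leftEnd c.unpair.2 = Q
  set M := 2 ^ l.length with hM
  have hM0 : 0 < M := by positivity
  have hM0' : (0 : ℝ) < M := by exact_mod_cast hM0
  set v : ℕ → ℝ := fun i => ‖cellValue 𝕜 s (positions s l.length) l i‖ with hv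
  have hv0 : ∀ i, 0 ≤ v i := fun i => norm_nonneg _
  have hcell : ∀ i < M, ((ratOfCode ((cellNormSqs (unitCode 𝕜) s l).getD i (0, 0, 0)) : ℚ) : ℝ) =
      v i ^ 2 := fun i hi => by rw [getD_cellNormSqs _ _ _ hi, ratOfCode_cellNormSq]
  have hconst : ∀ y : QCode, ∀ i < M,
      ((ratOfCode ((cellConst (QCode.mul y y) l).getD i (0, 0, 0)) : ℚ) : ℝ) =
        |((ratOfCode y : ℚ) : ℝ)| ^ 2 := fun y i hi => by
    rw [getD_cellConst _ _ hi, ratOfCode_mul, sq_abs]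
    push_cast
    ring
  -- An endpoint is compared as a sum of `M` equal powers, matching the factor `M` that multiplies
  -- the power of the norm.
  have hsumc : ∀ y : ℝ, ∑ i ∈ Finset.range M, y ^ p = y ^ p * M := fun y => by
    simp [mul_comm]
  have hlen1 := length_cellNormSqs (unitCode 𝕜) s l
  have hlen2 := fun y => length_cellConst y l
  have hzero : ∀ y, QCode.Lt (0, 0, 0) y ↔ 0 < ((ratOfCode y : ℚ) : ℝ) := fun y => by
    rw [QCode.lt_iff, ratOfCode_zero]
    exact_mod_cast Iff.rfl
  have hzero' : ∀ y, QCode.Lt y (0, 0, 0) ↔ ((ratOfCode y : ℚ) : ℝ) < 0 := fun y => by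
    rw [QCode.lt_iff, ratOfCode_zero]
    exact_mod_cast Iff.rfl
  have hpow : ∀ {a b : ℝ}, 0 ≤ a → 0 ≤ b → (a ^ p * M < b ^ p * M ↔ a < b) := fun ha hb => by
    rw [mul_lt_mul_iff_left₀ hM0', Real.rpow_lt_rpow_iff ha hb hp]
  constructor
  · rintro ⟨w, hbr, ⟨hR, hup⟩, hlow⟩
    obtain ⟨h0, h1, h2⟩ := hbr.bounds (hq _)
    rw [hzero] at hR
    constructor
    · rcases hlow with hlow | hlow
      · exact ((hzero' Q).1 hlow).trans_le hx
      · have h3 := hlow.sum_lt (a := fun _ => |((ratOfCode Q : ℚ) : ℝ)|) hM0 (hlen2 _) hlen1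
          (fun _ => abs_nonneg _) hv0 (hconst Q) hcell h0 h1 h2
        rw [hsumc, ← hsum, hpow (abs_nonneg _) hx] at h3
        exact (le_abs_self _).trans_lt h3
    · have h3 := hup.sum_lt (b := fun _ => |((ratOfCode R : ℚ) : ℝ)|) hM0 hlen1 (hlen2 _)
        hv0 (fun _ => abs_nonneg _) hcell (hconst R) h0 h1 h2
      rwa [hsumc, ← hsum, hpow hx (abs_nonneg _), abs_of_pos hR] at h3
  · rintro ⟨hQx, hxR⟩
    have hR : 0 < ((ratOfCode R : ℚ) : ℝ) := hx.trans_lt hxR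
    obtain ⟨w1, ε1, hε1, hw1⟩ := exists_sumPowLt (b := fun _ => |((ratOfCode R : ℚ) : ℝ)|) hp
      hlen1 (hlen2 _) hv0 (fun _ => abs_nonneg _) hcell (hconst R)
      (by rwa [hsumc, ← hsum, hpow hx (abs_nonneg _), abs_of_pos hR])
    have hlow : ∃ w2 : SumWitness, ∃ ε > 0, ∀ e : ExpPair,
        |((e.1.1 / (e.1.2 + 1) : ℚ) : ℝ) - p| < ε → |((e.2.1 / (e.2.2 + 1) : ℚ) : ℝ) - p| < ε →
        QCode.Lt Q (0, 0, 0) ∨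
          SumPowLt e w2 (cellConst (QCode.mul Q Q) l) (cellNormSqs (unitCode 𝕜) s l) := by
      -- A negative left end imposes no condition on a norm, and its square could not be used for
      -- the comparison.
      rcases lt_or_ge ((ratOfCode Q : ℚ) : ℝ) 0 with hQ | hQ
      · exact ⟨(0, [], []), 1, one_pos, fun e _ _ => Or.inl ((hzero' Q).2 hQ)⟩
      · obtain ⟨w2, ε2, hε2, hw2⟩ := exists_sumPowLt (a := fun _ => |((ratOfCode Q : ℚ) : ℝ)|) hp
          (hlen2 _) hlen1 (fun _ => abs_nonneg _) hv0 (hconst Q) hcell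
          (by rwa [hsumc, ← hsum, hpow (abs_nonneg _) hx, abs_of_nonneg hQ])
        exact ⟨w2, ε2, hε2, fun e h1 h2 => Or.inr (hw2 e h1 h2)⟩
    obtain ⟨w2, ε2, hε2, hw2⟩ := hlow
    -- One pair of exponents has to serve both inequalities, hence the minimum of the two
    -- tolerances.
    obtain ⟨e, k, hbr, h1, h2⟩ := exists_brackets hp (lt_min hε1 hε2) hq
    exact ⟨((e, k), w1, w2), hbr, ⟨(hzero R).2 hR,
      hw1 e (h1.trans_le (min_le_left _ _)) (h2.trans_le (min_le_left _ _))⟩,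
      hw2 e (h1.trans_le (min_le_right _ _)) (h2.trans_le (min_le_right _ _))⟩

theorem trivialPair_mem_diagram {𝕜 B : Type*} [RCLike 𝕜] [NormedAddCommGroup B]
    [NormedSpace 𝕜 B] (P : Presentation 𝕜 B) : trivialPair ∈ P.diagram := by
  have h0 : P.rationalVector 0 = 0 := by
    have : (Denumerable.ofNat (List ScalarCode) 0).length = 0 := by simp
    exact Finset.sum_eq_zero fun j _ => absurd j.2 (by simp)
  have h1 : intervalCode trivialPair.unpair.2 = ((0, 0, 0), (0, 0)) := by
    rw [trivialPair, Nat.unpair_pair]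
    exact Denumerable.ofNat_encode _
  change ‖P.rationalVector trivialPair.unpair.1‖ ∈ rationalInterval trivialPair.unpair.2
  rw [mem_rationalInterval_iff, leftEnd, rightEnd, h1, trivialPair, Nat.unpair_pair, h0]
  simp [ratOfCode, QCode.add, QCode.neg]

/-- Each output is either certified by a witness or is the default pair, which every diagram
contains; conversely each member of the diagram has a witness, and each pair of a code and a witness
is met at some argument. -/
theorem isName_diagramOperator {𝕜 : Type*} [RCLike 𝕜] {p : ℝ} [Fact (1 ≤ p)] {q : ℕ → QCode}
    (hq : ∀ k, |p - (ratOfCode (q k) : ℝ)| < (1 / 2 : ℝ) ^ k) {L : Type*} [LinearOrder L]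
    {e : L ↪ ℕ} {f : ℕ → Bool} (hf : IsDiagramBy e f) :
    (OrderLine.presentation 𝕜 (ENNReal.ofReal p) ENNReal.ofReal_ne_top hf).IsName
      (diagramOperator (unitCode 𝕜) q f) := by
  have hp : 0 < p := zero_lt_one.trans_le Fact.out
  set P := OrderLine.presentation 𝕜 (ENNReal.ofReal p) ENNReal.ofReal_ne_top hf with hP
  have key : ∀ c, (∃ w : DiagramWitness, DiagramCheck (unitCode 𝕜)
      (initialSegment f ((coefficients c.unpair.1).length * (coefficients c.unpair.1).length))
      c w (q w.1.2)) ↔ c ∈ P.diagram := fun c =>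
    exists_diagramCheck_iff hp (norm_nonneg _) hq (OrderLine.norm_of_ae_eq_lineValue hf _
      (OrderLine.coeFn_rationalVector hf ENNReal.ofReal_ne_top c.unpair.1))
  refine Set.Subset.antisymm ?_ fun c hc => ?_
  · rintro _ ⟨n, rfl⟩
    rw [diagramOperator, operatorStep]
    split_ifs with h
    · exact (key _).1 ⟨_, h⟩
    · exact trivialPair_mem_diagram P
  · obtain ⟨w, hw⟩ := (key c).2 hc
    obtain ⟨n, hn⟩ := queryCode_surjective (c, w)
    refine ⟨n, ?_⟩
    rw [diagramOperator, operatorStep, queryBound, hn, if_pos hw]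

end Diagram

theorem mainTheorem11 {𝕜 : Type*} [RCLike 𝕜] (p : ℝ) [Fact (1 ≤ p)] (hp : IsComputableReal p) :
    ∃ F : (ℕ → Bool) → (ℕ → ℕ), IsComputableOperator F ∧
      ∀ (f : ℕ → Bool) (L : Type*) [LinearOrder L], IsDiagramOf f L →
        ∃ (Ω : Type) (_ : MeasurableSpace Ω) (μ : Measure Ω)
          (P : Presentation 𝕜 (Lp 𝕜 (ENNReal.ofReal p) μ)),
          SigmaFinite μ ∧
          P.IsName (F f) ∧
          numAtoms μ = numAdjacencies L ∧
          (HasRationalInterval L →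
            Nonempty (Lp 𝕜 (ENNReal.ofReal p) (volume.restrict (Set.Icc (0 : ℝ) 1)) →ₗᵢ[𝕜]
              Lp 𝕜 (ENNReal.ofReal p) μ)) := by
  obtain ⟨q, hq, hqp⟩ := hp
  refine ⟨diagramOperator (unitCode 𝕜) q, isComputableOperator_diagramOperator _ hq,
    fun f L _ hfL => ?_⟩
  obtain ⟨e, hf⟩ := hfL
  have hf' : IsDiagramBy e f := hf
  have := OrderLine.isFiniteMeasure_height hf'
  have : Countable L := e.injective.countable
  exact ⟨_, _, OrderLine.measure (OrderLine.height e f),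
    OrderLine.presentation 𝕜 (ENNReal.ofReal p) ENNReal.ofReal_ne_top hf', inferInstance,
    isName_diagramOperator hqp hf',
    OrderLine.numAtoms_measure (strictMono_position hf') (gapsAreAdjacencies_position hf'),
    OrderLine.nonempty_embedding (strictMono_position hf') (gapsAreAdjacencies_position hf')
      ENNReal.ofReal_ne_top⟩
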